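/- **Setting.** A single item is offered to buyers $1,\dots,n$ in order, with values $v=(v_1,\dots,v_n)\in[0,1]^n$. A posted pricing policy is a vector of prices $\pi=(\pi_1,\dots,\pi_n)\in[0,1]^n$; the winner is the first buyer $i$ with $v_i\ge\pi_i$. The objective $\pi(v)$ is the value $v_i$ of the winner (welfare) or the price $\pi_i$ paid by the winner (revenue), and $0$ if nobody buys. For a probability distribution $\mathbf D$ on $[0,1]^n$ (the values may be arbitrarily correlated) and a class $\Pi$ of policies, let $\pi(\mathbf D)=\mathbb E_{v\sim\mathbf D}[\pi(v)]$ and $\Pi(\mathbf D)=\sup_{\pi\in\Pi}\pi(\mathbf D)$. A policy $\pi\in\Pi$ is an $\varepsilon$-approximation if $\pi(\mathbf D)\ge\Pi(\mathbf D)-\varepsilon$. The sample complexity is the least number $T$ of i.i.d. samples from $\mathbf D$ for which some (possibly randomized) learning algorithm, under every $\mathbf D$, returns an $\varepsilon$-approximation with probability at least $1-\delta$. Sample average approximation (SAA) returns a policy in $\Pi$ that maximizes the average objective over the samples. The pseudo-dimension of $\Pi$ is the largest size of a finite set of pairs $(v,z)\in[0,1]^n\times\mathbb R$ that is shattered by the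 indicators $(v,z)\mapsto\mathbf 1\{\pi(v)\ge z\}$, $\pi\in\Pi$. For $S\subseteq\{2,\dots,n\}$, let $\Pi_S$ be the class of policies $\pi\in[0,1]^n$ such that $\pi_i\ne\pi_{i-1}$ is allowed only when $i\in S$. **Theorem.** There is an absolute constant $C>0$ such that, for every $n$, every $S\subseteq\{2,\dots,n\}$, and for the welfare objective as well as for the revenue objective, the following holds with $k=1+|S|$. 1. The pseudo-dimension of $\Pi_S$ is at most $C\max(1,k\log k)$. 2. For all $\varepsilon,\delta\in(0,1)$, the sample complexity for the class $\Pi_S$, over all (arbitrarily correlated) distributions on $[0,1]^n$, is at most $$N:=C\,\frac{\max\bigl(1,\;k\log k+\log(1/\delta)\bigr)}{\varepsilon^2}.$$ 3. SAA achieves this bound: for every integer $T\ge N$, the average objective over any $T$ samples has a maximizer in $\Pi_S$, and for every distribution $\mathbf D$ on $[0,1]^n$, with probability at least $1-\delta$ over $T$ i.i.d. samples, every maximizer is an $\varepsilon$-approximation. (If $S\neq\emptyset$ then $k\log k\ge 2\log 2>1$ and both maxima equal their second entries, so the bounds are $O(k\log k)$ and $O\bigl((k\log k+\log(1/\delta))/\varepsilon^2\bigr)$.)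 -/

import Mathlib

noncomputable section

namespace PostedPricing

open MeasureTheory ProbabilityTheory

/-- Vectors in `[0,1]^n`. They serve both as vectors of buyer values and as posted pricing
policies (vectors of prices). The index `i : Fin n` stands for the buyer number `i + 1`. -/
abbrev UnitVec (n : ℕ) : Type := Fin n → unitInterval

/-- The two objectives. -/
inductive Objective where
  | welfare
  | revenue

/-- Buyer `i` wins: she is the first buyer whose value is at least the price offered to her. -/
def Wins {n : ℕ} (p v : UnitVec n) (i : Fin n) : Prop :=
  p i ≤ v i ∧ ∀ j : Fin n, j < i → v j < p j

/-- What is collected if buyer `i` wins: her value (welfare) or her price (revenue). -/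
def payoff {n : ℕ} (obj : Objective) (p v : UnitVec n) (i : Fin n) : ℝ :=
  match obj with
  | .welfare => (v i : ℝ)
  | .revenue => (p i : ℝ)

open Classical in
/-- The objective `π(v)` of policy `p` under values `v`. At most one buyer wins, so the sum
is the payoff of the winner, and it is `0` if the item is not sold. -/
def objective {n : ℕ} (obj : Objective) (p v : UnitVec n) : ℝ :=
  ∑ i : Fin n, if Wins p v i then payoff obj p v i else 0

/-- The expected objective `π(D)`. -/
def expectedObjective {n : ℕ} (obj : Objective) (D : Measure (UnitVec n)) (p : UnitVec n) : ℝ :=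
  ∫ v, objective obj p v ∂D

/-- The best expected objective `Π(D)` over a class of policies. -/
def optimum {n : ℕ} (obj : Objective) (P : Set (UnitVec n)) (D : Measure (UnitVec n)) : ℝ :=
  sSup (expectedObjective obj D '' P)

/-- `p` is an `ε`-approximation: a policy of the class `P` whose expected objective is within
`ε` of the best one. -/
def IsApprox {n : ℕ} (obj : Objective) (P : Set (UnitVec n)) (D : Measure (UnitVec n)) (ε : ℝ)
    (p : UnitVec n) : Prop :=
  p ∈ P ∧ optimum obj P D - ε ≤ expectedObjective obj D p

/-- The class `Π_S` of the policies that respect the change-points `S`: the price offered to a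
buyer can differ from the price offered to the previous buyer only at a member of `S`. -/
def changePointClass {n : ℕ} (S : Finset (Fin n)) : Set (UnitVec n) :=
  {p | ∀ i j : Fin n, (j : ℕ) = (i : ℕ) + 1 → j ∉ S → p j = p i}

/-- The law of `T` IID samples from `D`. -/
def sampleLaw {n : ℕ} (T : ℕ) (D : Measure (UnitVec n)) : Measure (Fin T → UnitVec n) :=
  Measure.pi fun _ => D

/-- `T` samples suffice: some (possibly randomized) learning algorithm, that is, a Markov kernel
from sample vectors to policies, returns under every distribution `D` on `[0,1]^n` an
`ε`-approximation with probability at least `1 - δ`, over the samples and the random bits. -/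
def SamplesSuffice {n : ℕ} (obj : Objective) (P : Set (UnitVec n)) (ε δ : ℝ) (T : ℕ) : Prop :=
  ∃ alg : Kernel (Fin T → UnitVec n) (UnitVec n), IsMarkovKernel alg ∧
    ∀ D : Measure (UnitVec n), IsProbabilityMeasure D →
      ENNReal.ofReal (1 - δ) ≤ ((sampleLaw T D).bind alg) {p | IsApprox obj P D ε p}

/-- The sample complexity: the least number of samples that suffices (`⊤` if there is none). -/
def sampleComplexity {n : ℕ} (obj : Objective) (P : Set (UnitVec n)) (ε δ : ℝ) : ℕ∞ :=
  ⨅ (T : ℕ) (_ : SamplesSuffice obj P ε δ T), (T : ℕ∞)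

/-- The objective of policy `p` averaged over the samples `x`. -/
def empiricalObjective {n T : ℕ} (obj : Objective) (x : Fin T → UnitVec n) (p : UnitVec n) : ℝ :=
  (1 / (T : ℝ)) * ∑ t : Fin T, objective obj p (x t)

/-- `p` is a possible output of sample average approximation (SAA) on the samples `x`: a policy
of the class `P` with the highest objective averaged over the samples. -/
def IsSAA {n T : ℕ} (obj : Objective) (P : Set (UnitVec n)) (x : Fin T → UnitVec n)
    (p : UnitVec n) : Prop :=
  p ∈ P ∧ ∀ q ∈ P, empiricalObjective obj x q ≤ empiricalObjective obj x p

/-- The finite set `A` of pairs `(x, z)` is shattered by the indicators `(x, z) ↦ 1{f x ≥ z}`,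
`f ∈ F`. -/
def PseudoShatters {X : Type*} (F : Set (X → ℝ)) (A : Finset (X × ℝ)) : Prop :=
  ∀ B ⊆ A, ∃ f ∈ F, ∀ a ∈ A, a.2 ≤ f a.1 ↔ a ∈ B

/-- The pseudo-dimension of a class of real functions: the largest size of a shattered set
(`⊤` if there is none). -/
def pseudoDim {X : Type*} (F : Set (X → ℝ)) : ℕ∞ :=
  ⨆ (A : Finset (X × ℝ)) (_ : PseudoShatters F A), (A.card : ℕ∞)

end PostedPricing

end

noncomputable section

namespace PostedPricing

open MeasureTheory ProbabilityTheory

/-! ### First entry that passes a test -/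

section First

variable {ι : Type*} [LinearOrder ι]

/-! The change-points cut the buyers into k = |S| + 1 consecutive blocks, and a policy of the class
is a choice of one price per block. Fix values v and a block, and record the payoff collected there
at price t, with the value 2 if the block does not buy. This is monotone in t for both objectives
(`blockPayoff_mono`). The objective is the first block payoff different from 2
(`objective_blockPolicy`), so it is 1-Lipschitz in the ℓ¹ distance of the block payoffs
(`abs_objective_blockPolicy_sub_le`). Both bounds use only these two facts.

Pseudo-dimension: on m pairs (v, z), the labels are determined by which block payoffs are at least 2
and which are at least z. For each block these are two chains of subsets as the price moves, so the
pair of subsets takes at most 2m + 1 values. Hence 2^m ≤ (2m + 1)^k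
(`two_pow_card_le_of_pseudoShatters`), which forces m = O(k log k).

Samples: for a given D, cut the prices of each block according to the mean block payoff. By
monotonicity, the oscillation in a cell is dominated by a single function of small mean, so there
are at most (2k·4^j + 1)^k cells of policies with mean oscillation at most 4^(-j)
(`exists_product_cells`). These brackets are chained. A link at level j has values in [-1, 1] and
mean absolute value O(4^(-j)), hence variance of that order, and Bernstein's inequality controls it
up to a deviation of order ε(j + 1)/2^j. The failure exponent Tε²(j + 1)² beats the logarithm of the
number of links, O(max(1, k log k)(j + 1)), so no factor log(1/ε) is lost
(`measure_exists_deviation_gt_le`). Uniform deviation at most ε/2 makes every empirical maximizer an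
ε-approximation. Maximizers exist because rounding each block price up to a sampled value, or to 1,
never hurts (`exists_candidatePolicy_ge`). -/

/-- `i` is the least index that satisfies `P`. -/
def IsFirst (P : ι → Prop) (i : ι) : Prop := P i ∧ ∀ j < i, ¬ P j

theorem IsFirst.unique {P : ι → Prop} {i j : ι} (hi : IsFirst P i) (hj : IsFirst P j) : i = j := by
  rcases lt_trichotomy i j with h | h | h
  · exact absurd hi.1 (hj.2 i h)
  · exact h
  · exact absurd hj.1 (hi.2 j h)

variable [Fintype ι]

theorem exists_isFirst {P : ι → Prop} (h : ∃ i, P i) : ∃ i, IsFirst P i := by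
  obtain ⟨i, hi, hm⟩ := (Set.toFinite {i | P i}).exists_minimal h
  exact ⟨i, hi, fun j hj hP => absurd (hm hP hj.le) (not_le.2 hj)⟩

open Classical in
/-- The value of `f` at the least index that satisfies `P`, or `d` if there is none. -/
def firstValue (P : ι → Prop) (f : ι → ℝ) (d : ℝ) : ℝ :=
  (∑ i, if IsFirst P i then f i else 0) + if ∃ i, P i then 0 else d

theorem firstValue_of_isFirst {P : ι → Prop} {i : ι} (hi : IsFirst P i) (f : ι → ℝ) (d : ℝ) :
    firstValue P f d = f i := by
  classical
  have h : ∃ i, P i := ⟨i, hi.1⟩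
  rw [firstValue, if_pos h, add_zero, Finset.sum_eq_single i, if_pos hi]
  · intro j _ hj
    exact if_neg fun h' => hj (h'.unique hi)
  · simp

theorem firstValue_of_not_exists {P : ι → Prop} (h : ¬ ∃ i, P i) (f : ι → ℝ) (d : ℝ) :
    firstValue P f d = d := by
  classical
  rw [firstValue, if_neg h, Finset.sum_eq_zero, zero_add]
  intro i _
  exact if_neg fun h' => h ⟨i, h'.1⟩

theorem measurable_firstValue {X : Type*} [MeasurableSpace X] {P : X → ι → Prop} {f : X → ι → ℝ}
    (hP : ∀ i, MeasurableSet {x | P x i}) (hf : ∀ i, Measurable fun x => f x i) (d : ℝ) :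
    Measurable fun x => firstValue (P x) (f x) d := by
  classical
  unfold firstValue
  refine (Finset.measurable_sum _ fun i _ => Measurable.ite ?_ (hf i) measurable_const).add
    (Measurable.ite ?_ measurable_const measurable_const)
  · have : {x | IsFirst (P x) i} = {x | P x i} ∩ ⋂ j, ⋂ (_ : j < i), {x | P x j}ᶜ := by
      ext x
      simp [IsFirst]
    rw [this]
    exact (hP i).inter (MeasurableSet.iInter fun j => MeasurableSet.iInter fun _ => (hP j).compl)
  · have : {x | ∃ i, P x i} = ⋃ i, {x | P x i} := by
      ext x
      simp
    rw [this]
    exact MeasurableSet.iUnion hP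

/-- Reading off the first entry different from `2` is `1`-Lipschitz for the `ℓ¹` distance on
vectors with entries in `[0, 1] ∪ {2}`. -/
theorem abs_firstValue_sub_le {y z : ι → ℝ} (hy : ∀ i, y i ∈ Set.Icc (0 : ℝ) 1 ∨ y i = 2)
    (hz : ∀ i, z i ∈ Set.Icc (0 : ℝ) 1 ∨ z i = 2) :
    |firstValue (fun i => y i ≠ 2) y 0 - firstValue (fun i => z i ≠ 2) z 0| ≤
      ∑ i, |y i - z i| := by
  have hsum : ∀ i, |y i - z i| ≤ ∑ i, |y i - z i| := fun i =>
    Finset.single_le_sum (f := fun i => |y i - z i|) (fun _ _ => abs_nonneg _) (Finset.mem_univ i)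
  have hval : ∀ w : ι → ℝ, (∀ i, w i ∈ Set.Icc (0 : ℝ) 1 ∨ w i = 2) →
      firstValue (fun i => w i ≠ 2) w 0 ∈ Set.Icc (0 : ℝ) 1 := by
    intro w hw
    by_cases h : ∃ i, w i ≠ 2
    · obtain ⟨i, hi⟩ := exists_isFirst h
      rw [firstValue_of_isFirst hi]
      exact (hw i).resolve_right hi.1
    · rw [firstValue_of_not_exists h]
      simp
  -- Compare at the first index where either entry differs from 2. If only one does, the entries
  -- there are at least 1 apart, which already exceeds the distance of any two values in [0, 1].
  by_cases h : ∃ i, y i ≠ 2 ∨ z i ≠ 2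
  · obtain ⟨i, hi, hlt⟩ := exists_isFirst h
    have hly : ∀ j < i, ¬ y j ≠ 2 := fun j hj h' => hlt j hj (Or.inl h')
    have hlz : ∀ j < i, ¬ z j ≠ 2 := fun j hj h' => hlt j hj (Or.inr h')
    refine le_trans ?_ (hsum i)
    have h1 := hval y hy
    have h2 := hval z hz
    by_cases hyi : y i = 2
    · have hzi : z i ≠ 2 := hi.resolve_left (by simp [hyi])
      have h3 := (hz i).resolve_right hzi
      rw [hyi]
      rw [abs_of_nonneg (by linarith [h3.2] : (0 : ℝ) ≤ 2 - z i), abs_le]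
      constructor <;> linarith [h1.1, h1.2, h2.1, h2.2, h3.2]
    · by_cases hzi : z i = 2
      · have h3 := (hy i).resolve_right hyi
        rw [hzi]
        rw [abs_of_nonpos (by linarith [h3.2] : y i - 2 ≤ 0), abs_le]
        constructor <;> linarith [h1.1, h1.2, h2.1, h2.2, h3.2]
      · rw [firstValue_of_isFirst (i := i) ⟨hyi, hly⟩, firstValue_of_isFirst (i := i) ⟨hzi, hlz⟩]
  · rw [not_exists] at h
    rw [firstValue_of_not_exists, firstValue_of_not_exists]
    · simpa using Finset.sum_nonneg fun i _ => abs_nonneg (y i - z i)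
    · rintro ⟨i, hi⟩
      exact h i (Or.inr hi)
    · rintro ⟨i, hi⟩
      exact h i (Or.inl hi)

end First

/-! ### Block prices and monotone block payoffs -/

section Blocks

variable {n : ℕ}

theorem objective_eq_firstValue (obj : Objective) (p v : UnitVec n) :
    objective obj p v = firstValue (fun i => p i ≤ v i) (payoff obj p v) 0 := by
  classical
  simp only [objective, firstValue, ite_self, add_zero]
  refine Finset.sum_congr rfl fun i _ => ?_
  simp only [Wins, IsFirst, not_le]
  congr

theorem payoff_mem_Icc (obj : Objective) (p v : UnitVec n) (i : Fin n) :
    payoff obj p v i ∈ Set.Icc (0 : ℝ) 1 := by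
  cases obj
  · exact (v i).2
  · exact (p i).2

theorem objective_mem_Icc (obj : Objective) (p v : UnitVec n) :
    objective obj p v ∈ Set.Icc (0 : ℝ) 1 := by
  rw [objective_eq_firstValue]
  by_cases h : ∃ i, p i ≤ v i
  · obtain ⟨i, hi⟩ := exists_isFirst h
    rw [firstValue_of_isFirst hi]
    exact payoff_mem_Icc ..
  · rw [firstValue_of_not_exists h]
    simp

theorem measurable_objective_uncurry (obj : Objective) :
    Measurable fun a : UnitVec n × UnitVec n => objective obj a.1 a.2 := by
  simp only [objective_eq_firstValue]
  refine measurable_firstValue (fun i => ?_) (fun i => ?_) 0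
  · exact measurableSet_le ((measurable_pi_apply i).comp measurable_fst)
      ((measurable_pi_apply i).comp measurable_snd)
  · cases obj
    · exact measurable_subtype_coe.comp ((measurable_pi_apply i).comp measurable_snd)
    · exact measurable_subtype_coe.comp ((measurable_pi_apply i).comp measurable_fst)

theorem measurable_objective (obj : Objective) (p : UnitVec n) : Measurable (objective obj p) :=
  (measurable_objective_uncurry obj).comp measurable_prodMk_left

/-- The index of the block of buyers that are offered the same price as buyer `i` by all policies
that respect the change-points `S`. -/
def blockIndex (S : Finset (Fin n)) (i : Fin n) : Fin (S.card + 1) :=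
  ⟨(S.filter (· ≤ i)).card, Nat.lt_succ_of_le (Finset.card_filter_le _ _)⟩

theorem blockIndex_mono (S : Finset (Fin n)) : Monotone (blockIndex S) := by
  intro i j h
  refine Fin.mk_le_mk.2 (Finset.card_le_card fun l hl => ?_)
  rw [Finset.mem_filter] at hl ⊢
  exact ⟨hl.1, hl.2.trans h⟩

/-- The policy that offers the price `θ β` to the buyers of block `β`. -/
def blockPolicy (S : Finset (Fin n)) (θ : Fin (S.card + 1) → unitInterval) : UnitVec n :=
  fun i => θ (blockIndex S i)

theorem blockPolicy_mem (S : Finset (Fin n)) (θ : Fin (S.card + 1) → unitInterval) :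
    blockPolicy S θ ∈ changePointClass S := by
  intro i j hij hj
  have : blockIndex S j = blockIndex S i := by
    refine Fin.mk_eq_mk.2 (congrArg Finset.card (Finset.filter_congr fun l hl => ?_))
    have : l ≠ j := fun h => hj (h ▸ hl)
    rw [ne_eq, Fin.ext_iff] at this
    rw [Fin.le_def, Fin.le_def]
    omega
  rw [blockPolicy, blockPolicy, this]

/-- Between two buyers with the same index the count of change-points is constant, so no step
crosses a member of `S` and the price is carried along one buyer at a time. -/
theorem eq_of_blockIndex_eq {S : Finset (Fin n)} {p : UnitVec n} (hp : p ∈ changePointClass S)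
    {i j : Fin n} (h : blockIndex S i = blockIndex S j) : p i = p j := by
  wlog hij : i ≤ j generalizing i j
  · exact (this h.symm (not_le.1 hij).le).symm
  obtain ⟨i, hi⟩ := i
  obtain ⟨j, hj⟩ := j
  rw [Fin.mk_le_mk] at hij
  induction j, hij using Nat.le_induction with
  | base => rfl
  | succ j hij ih =>
    have hj' : j < n := by omega
    have h1 : blockIndex S ⟨i, hi⟩ ≤ blockIndex S ⟨j, hj'⟩ := blockIndex_mono S (Fin.mk_le_mk.2 hij)
    have h2 : blockIndex S ⟨j, hj'⟩ ≤ blockIndex S ⟨j + 1, hj⟩ :=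
      blockIndex_mono S (Fin.mk_le_mk.2 (Nat.le_succ j))
    have h3 : blockIndex S ⟨i, hi⟩ = blockIndex S ⟨j, hj'⟩ := le_antisymm h1 (h ▸ h2)
    rw [ih hj' h3]
    refine (hp ⟨j, hj'⟩ ⟨j + 1, hj⟩ rfl fun hmem => ?_).symm
    have h4 : (S.filter (· ≤ (⟨j, hj'⟩ : Fin n))).card = (S.filter (· ≤ (⟨j + 1, hj⟩ : Fin n))).card :=
      Fin.mk_eq_mk.1 (h3.symm.trans h)
    refine absurd h4 (Finset.card_lt_card ?_).ne
    refine Finset.ssubset_iff_of_subset (fun l hl => ?_) |>.2 ⟨⟨j + 1, hj⟩, ?_, ?_⟩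
    · rw [Finset.mem_filter, Fin.le_def] at hl ⊢
      exact ⟨hl.1, hl.2.trans (Nat.le_succ j)⟩
    · simp [hmem]
    · simp

theorem exists_blockPolicy_eq {S : Finset (Fin n)} {p : UnitVec n} (hp : p ∈ changePointClass S) :
    ∃ θ, blockPolicy S θ = p := by
  classical
  refine ⟨fun β => if h : ∃ i, blockIndex S i = β then p h.choose else 0, funext fun i => ?_⟩
  have h : ∃ j, blockIndex S j = blockIndex S i := ⟨i, rfl⟩
  simp only [blockPolicy]
  rw [dif_pos h]
  exact eq_of_blockIndex_eq hp h.choose_spec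

theorem changePointClass_eq_range (S : Finset (Fin n)) :
    changePointClass S = Set.range (blockPolicy S) :=
  Set.Subset.antisymm (fun _ hp => exists_blockPolicy_eq hp)
    (by rintro _ ⟨θ, rfl⟩; exact blockPolicy_mem S θ)

/-- The payoff collected from block `β` at the price `t` if the item is still available there, or
`2` if the item is not sold in this block. -/
def blockPayoff (obj : Objective) (S : Finset (Fin n)) (β : Fin (S.card + 1)) (t : unitInterval)
    (v : UnitVec n) : ℝ :=
  firstValue (fun i => blockIndex S i = β ∧ t ≤ v i) (payoff obj (fun _ => t) v) 2

theorem blockPayoff_mem (obj : Objective) (S : Finset (Fin n)) (β : Fin (S.card + 1))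
    (t : unitInterval) (v : UnitVec n) :
    blockPayoff obj S β t v ∈ Set.Icc (0 : ℝ) 1 ∨ blockPayoff obj S β t v = 2 := by
  by_cases h : ∃ i, blockIndex S i = β ∧ t ≤ v i
  · obtain ⟨i, hi⟩ := exists_isFirst h
    left
    rw [blockPayoff, firstValue_of_isFirst hi]
    exact payoff_mem_Icc ..
  · right
    rw [blockPayoff, firstValue_of_not_exists h]

theorem blockPayoff_mem_Icc (obj : Objective) (S : Finset (Fin n)) (β : Fin (S.card + 1))
    (t : unitInterval) (v : UnitVec n) : blockPayoff obj S β t v ∈ Set.Icc (0 : ℝ) 2 := by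
  rcases blockPayoff_mem obj S β t v with h | h
  · exact ⟨h.1, h.2.trans one_le_two⟩
  · simp [h]

theorem blockPayoff_ne_two_iff (obj : Objective) (S : Finset (Fin n)) (β : Fin (S.card + 1))
    (t : unitInterval) (v : UnitVec n) :
    blockPayoff obj S β t v ≠ 2 ↔ ∃ i, blockIndex S i = β ∧ t ≤ v i := by
  constructor
  · intro h
    by_contra h'
    exact h (firstValue_of_not_exists h' _ _)
  · intro h
    obtain ⟨i, hi⟩ := exists_isFirst h
    rw [blockPayoff, firstValue_of_isFirst hi]
    exact ((payoff_mem_Icc obj (fun _ => t) v i).2.trans_lt one_lt_two).ne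

theorem measurable_blockPayoff (obj : Objective) (S : Finset (Fin n)) (β : Fin (S.card + 1))
    (t : unitInterval) : Measurable (blockPayoff obj S β t) := by
  refine measurable_firstValue (fun i => ?_) (fun i => ?_) 2
  · exact (MeasurableSet.const _).inter
      (measurableSet_le (f := fun _ : UnitVec n => t) measurable_const (measurable_pi_apply i))
  · cases obj
    · exact measurable_subtype_coe.comp (measurable_pi_apply i)
    · exact measurable_const

/-- Raising the price keeps the first accepting buyer or moves to a later one. A buyer lost this way
has a value below the new price, hence below the value of the new winner; for revenue the payoff is
the price itself. The value 2 for an unsold block lies above all payoffs, so losing the sale is also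
an increase. -/
theorem blockPayoff_mono (obj : Objective) (S : Finset (Fin n)) (β : Fin (S.card + 1))
    (v : UnitVec n) : Monotone fun t => blockPayoff obj S β t v := by
  intro t u htu
  by_cases h : ∃ i, blockIndex S i = β ∧ u ≤ v i
  · obtain ⟨i, hi⟩ := exists_isFirst h
    have h' : ∃ i, blockIndex S i = β ∧ t ≤ v i := ⟨i, hi.1.1, htu.trans hi.1.2⟩
    obtain ⟨j, hj⟩ := exists_isFirst h'
    simp only [blockPayoff]
    rw [firstValue_of_isFirst hi, firstValue_of_isFirst hj]
    cases obj
    · rcases lt_trichotomy i j with hlt | heq | hlt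
      · exact absurd ⟨hi.1.1, htu.trans hi.1.2⟩ (hj.2 i hlt)
      · rw [heq]
        exact le_rfl
      · have hlt' : v j < u := not_le.1 fun hle => hi.2 j hlt ⟨hj.1.1, hle⟩
        exact (hlt'.trans_le hi.1.2).le
    · exact htu
  · have : blockPayoff obj S β u v = 2 := firstValue_of_not_exists h _ _
    simp only [this]
    exact (blockPayoff_mem_Icc obj S β t v).2

/-- The objective is the first of the block payoffs of the blocks where the item is sold. -/
theorem objective_blockPolicy (obj : Objective) (S : Finset (Fin n))
    (θ : Fin (S.card + 1) → unitInterval) (v : UnitVec n) :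
    objective obj (blockPolicy S θ) v =
      firstValue (fun β => blockPayoff obj S β (θ β) v ≠ 2)
        (fun β => blockPayoff obj S β (θ β) v) 0 := by
  rw [objective_eq_firstValue]
  by_cases h : ∃ i, blockPolicy S θ i ≤ v i
  · obtain ⟨i, hi⟩ := exists_isFirst h
    have hfirst : IsFirst (fun j => blockIndex S j = blockIndex S i ∧ θ (blockIndex S i) ≤ v j) i :=
      ⟨⟨rfl, hi.1⟩, fun j hj hj' => hi.2 j hj (by simpa only [blockPolicy, hj'.1] using hj'.2)⟩
    have hβ : IsFirst (fun β => blockPayoff obj S β (θ β) v ≠ 2) (blockIndex S i) := by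
      refine ⟨(blockPayoff_ne_two_iff ..).2 ⟨i, rfl, hi.1⟩, fun β hβ hne => ?_⟩
      obtain ⟨j, hj, hle⟩ := (blockPayoff_ne_two_iff ..).1 hne
      subst hj
      exact hi.2 j ((blockIndex_mono S).reflect_lt hβ) hle
    rw [firstValue_of_isFirst hi, firstValue_of_isFirst hβ, blockPayoff,
      firstValue_of_isFirst hfirst]
    cases obj <;> rfl
  · rw [firstValue_of_not_exists h, firstValue_of_not_exists]
    rintro ⟨β, hβ⟩
    obtain ⟨j, hj, hle⟩ := (blockPayoff_ne_two_iff ..).1 hβ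
    subst hj
    exact h ⟨j, hle⟩

theorem abs_objective_blockPolicy_sub_le (obj : Objective) (S : Finset (Fin n))
    (θ θ' : Fin (S.card + 1) → unitInterval) (v : UnitVec n) :
    |objective obj (blockPolicy S θ) v - objective obj (blockPolicy S θ') v| ≤
      ∑ β, |blockPayoff obj S β (θ β) v - blockPayoff obj S β (θ' β) v| := by
  rw [objective_blockPolicy, objective_blockPolicy]
  exact abs_firstValue_sub_le (fun β => blockPayoff_mem ..) fun β => blockPayoff_mem ..

end Blocks

/-! ### Pseudo-dimension by counting label patterns -/

section PseudoDimension

/-- The members of a finite set that pass a threshold, for a monotone family of functions, depend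
only on their number. -/
theorem filter_eq_filter_of_card_add_card_eq {α τ : Type*} [LinearOrder τ] (A : Finset α)
    {P Q : τ → α → Prop} [∀ t, DecidablePred (P t)] [∀ t, DecidablePred (Q t)]
    (hP : ∀ a, Monotone fun t => P t a) (hQ : ∀ a, Monotone fun t => Q t a) {t u : τ}
    (h : (A.filter (P t)).card + (A.filter (Q t)).card =
      (A.filter (P u)).card + (A.filter (Q u)).card) :
    A.filter (P t) = A.filter (P u) ∧ A.filter (Q t) = A.filter (Q u) := by
  wlog htu : t ≤ u generalizing t u
  · obtain ⟨h1, h2⟩ := this h.symm (not_le.1 htu).le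
    exact ⟨h1.symm, h2.symm⟩
  have h1 : A.filter (P t) ⊆ A.filter (P u) := Finset.monotone_filter_right A fun a _ => hP a htu
  have h2 : A.filter (Q t) ⊆ A.filter (Q u) := Finset.monotone_filter_right A fun a _ => hQ a htu
  have h3 := Finset.card_le_card h1
  have h4 := Finset.card_le_card h2
  exact ⟨Finset.eq_of_subset_of_card_le h1 (by omega),
    Finset.eq_of_subset_of_card_le h2 (by omega)⟩

variable {n : ℕ}

/-- The comparisons with 2 determine which block sells first, and the comparison with `z` in that
block then decides the label. -/
theorem le_objective_blockPolicy_iff (obj : Objective) (S : Finset (Fin n))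
    {θ θ' : Fin (S.card + 1) → unitInterval} {v : UnitVec n} {z : ℝ}
    (hsold : ∀ β, 2 ≤ blockPayoff obj S β (θ β) v ↔ 2 ≤ blockPayoff obj S β (θ' β) v)
    (hz : ∀ β, z ≤ blockPayoff obj S β (θ β) v ↔ z ≤ blockPayoff obj S β (θ' β) v) :
    z ≤ objective obj (blockPolicy S θ) v ↔ z ≤ objective obj (blockPolicy S θ') v := by
  have htwo : ∀ β (t : unitInterval), 2 ≤ blockPayoff obj S β t v ↔
      blockPayoff obj S β t v = 2 := fun β t =>
    ⟨fun h => le_antisymm (blockPayoff_mem_Icc obj S β t v).2 h, fun h => h.ge⟩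
  simp only [htwo] at hsold
  rw [objective_blockPolicy, objective_blockPolicy]
  simp only [ne_eq, hsold]
  by_cases h : ∃ β, ¬ blockPayoff obj S β (θ' β) v = 2
  · obtain ⟨β, hβ⟩ := exists_isFirst h
    rw [firstValue_of_isFirst hβ, firstValue_of_isFirst hβ]
    exact hz β
  · rw [firstValue_of_not_exists h, firstValue_of_not_exists h]

theorem two_pow_card_le_of_pseudoShatters (obj : Objective) (S : Finset (Fin n))
    {A : Finset (UnitVec n × ℝ)} (hA : PseudoShatters (objective obj '' changePointClass S) A) :
    2 ^ A.card ≤ (2 * A.card + 1) ^ (S.card + 1) := by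
  classical
  have hex : ∀ B : Finset (UnitVec n × ℝ), ∃ θ : Fin (S.card + 1) → unitInterval, B ⊆ A →
      ∀ a ∈ A, a.2 ≤ objective obj (blockPolicy S θ) a.1 ↔ a ∈ B := by
    intro B
    by_cases hB : B ⊆ A
    · obtain ⟨_, ⟨p, hp, rfl⟩, h⟩ := hA B hB
      obtain ⟨θ, rfl⟩ := exists_blockPolicy_eq hp
      exact ⟨θ, fun _ => h⟩
    · exact ⟨fun _ => 0, fun h => absurd h hB⟩
  choose θ hθ using hex
  let P : Fin (S.card + 1) → unitInterval → UnitVec n × ℝ → Prop :=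
    fun β t a => 2 ≤ blockPayoff obj S β t a.1
  let Q : Fin (S.card + 1) → unitInterval → UnitVec n × ℝ → Prop :=
    fun β t a => a.2 ≤ blockPayoff obj S β t a.1
  -- Both filters grow with the price, so the sum of their sizes, a number from 0 to 2m with m =
  -- `A.card`, determines both. This gives 2m + 1 rather than (m + 1)² patterns per block.
  let count : Finset (UnitVec n × ℝ) → Fin (S.card + 1) → Fin (2 * A.card + 1) := fun B β =>
    ⟨(A.filter (P β (θ B β))).card + (A.filter (Q β (θ B β))).card, by
      have h1 := Finset.card_filter_le A (P β (θ B β))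
      have h2 := Finset.card_filter_le A (Q β (θ B β))
      omega⟩
  have hinj : Set.InjOn count (A.powerset : Set (Finset (UnitVec n × ℝ))) := by
    intro B hB B' hB' h
    rw [Finset.mem_coe, Finset.mem_powerset] at hB hB'
    have hfil : ∀ β, A.filter (P β (θ B β)) = A.filter (P β (θ B' β)) ∧
        A.filter (Q β (θ B β)) = A.filter (Q β (θ B' β)) := fun β =>
      filter_eq_filter_of_card_add_card_eq A (P := P β) (Q := Q β)
        (fun a t u htu h => h.trans (blockPayoff_mono obj S β a.1 htu))
        (fun a t u htu h => h.trans (blockPayoff_mono obj S β a.1 htu))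
        (Fin.mk_eq_mk.1 (congrFun h β))
    ext a
    by_cases ha : a ∈ A
    · rw [← hθ B hB a ha, ← hθ B' hB' a ha]
      refine le_objective_blockPolicy_iff obj S (fun β => ?_) fun β => ?_
      · simpa [ha, P] using Finset.ext_iff.1 (hfil β).1 a
      · simpa [ha, Q] using Finset.ext_iff.1 (hfil β).2 a
    · exact iff_of_false (fun h => ha (hB h)) fun h => ha (hB' h)
  have := Finset.card_le_card_of_injOn count (fun _ _ => Finset.mem_univ _) hinj
  simpa using this

theorem self_le_two_mul_max (k : ℕ) : (k : ℝ) ≤ 2 * max 1 (k * Real.log k) := by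
  rcases Nat.lt_or_ge k 2 with h | h
  · have : (k : ℝ) ≤ 1 := by exact_mod_cast Nat.le_of_lt_succ h
    linarith [le_max_left 1 ((k : ℝ) * Real.log k)]
  · have h2 : (2 : ℝ) ≤ k := by exact_mod_cast h
    have hlog : Real.log 2 ≤ Real.log k := Real.log_le_log two_pos h2
    have := Real.log_two_gt_d9
    nlinarith [le_max_right 1 ((k : ℝ) * Real.log k)]

theorem le_of_two_pow_le {m k : ℕ} (hk : 1 ≤ k) (h : 2 ^ m ≤ (2 * m + 1) ^ k) :
    (m : ℝ) ≤ 20 * max 1 (k * Real.log k) := by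
  have hk' : (1 : ℝ) ≤ k := by exact_mod_cast hk
  have h1 : (m : ℝ) * Real.log 2 ≤ k * Real.log (2 * m + 1) := by
    have : ((2 : ℝ) ^ m) ≤ (2 * m + 1) ^ k := by exact_mod_cast h
    have := Real.log_le_log (by positivity) this
    rwa [Real.log_pow, Real.log_pow] at this
  -- The tangent bound log x ≤ x - 1 at x = (2m + 1)/(8k). After multiplication by k the term linear
  -- in m is m/4, which m log 2 absorbs.
  have h2 : Real.log (2 * m + 1) ≤ Real.log 8 + Real.log k + ((2 * m + 1) / (8 * k) - 1) := by
    have h3 : (2 * m + 1 : ℝ) = 8 * k * ((2 * m + 1) / (8 * k)) := by field_simp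
    conv_lhs => rw [h3]
    rw [Real.log_mul (by positivity) (by positivity), Real.log_mul (by norm_num) (by positivity)]
    linarith [Real.log_le_sub_one_of_pos (show (0 : ℝ) < (2 * m + 1) / (8 * k) by positivity)]
  have h8 : Real.log 8 = 3 * Real.log 2 := by
    rw [show (8 : ℝ) = 2 ^ 3 by norm_num, Real.log_pow]
    norm_num
  have h4 : (k : ℝ) * Real.log (2 * m + 1) ≤
      k * Real.log 8 + k * Real.log k + ((2 * m + 1) / 8 - k) := by
    have h5 : (k : ℝ) * ((2 * m + 1) / (8 * k)) = (2 * m + 1) / 8 := by field_simp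
    nlinarith [mul_le_mul_of_nonneg_left h2 (by positivity : (0 : ℝ) ≤ k)]
  have h6 := self_le_two_mul_max k
  have h7 := le_max_right 1 ((k : ℝ) * Real.log k)
  have h9 := Real.log_two_gt_d9
  have h10 := Real.log_two_lt_d9
  have h11 : (m : ℝ) * 0.69 ≤ m * Real.log 2 := by gcongr; linarith
  have h12 : (k : ℝ) * Real.log 8 ≤ k * 2.1 := by gcongr; linarith
  linarith [le_max_left 1 ((k : ℝ) * Real.log k)]

theorem pseudoDim_changePointClass_le (obj : Objective) (S : Finset (Fin n)) :
    ((pseudoDim (objective obj '' changePointClass S) : ℕ∞) : ENNReal) ≤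
      ENNReal.ofReal (20 * max 1 ((1 + (S.card : ℝ)) * Real.log (1 + (S.card : ℝ)))) := by
  set b : ℝ := 20 * max 1 ((1 + (S.card : ℝ)) * Real.log (1 + (S.card : ℝ))) with hb
  have hb0 : 0 ≤ b := by positivity
  have h : pseudoDim (objective obj '' changePointClass S) ≤ (⌊b⌋₊ : ℕ∞) := by
    refine iSup₂_le fun A hA => ?_
    refine Nat.cast_le.2 (Nat.le_floor ?_)
    have := le_of_two_pow_le (Nat.succ_le_succ (Nat.zero_le _))
      (two_pow_card_le_of_pseudoShatters obj S hA)
    push_cast at this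
    rwa [add_comm (S.card : ℝ) 1] at this
  refine (ENat.toENNReal_le.2 h).trans ?_
  rw [ENat.toENNReal_coe, ← ENNReal.ofReal_natCast]
  exact ENNReal.ofReal_le_ofReal (Nat.floor_le hb0)

end PseudoDimension

/-! ### Brackets for monotone families -/

section Cells

variable {X : Type*} [MeasurableSpace X] (μ : Measure X) [IsProbabilityMeasure μ]

theorem exists_monotone_cofinal {I : Set unitInterval} [I.OrdConnected] (hI : I.Nonempty) :
    ∃ u : ℕ → I, Monotone u ∧ ∀ p ∈ I, ∃ m, p ≤ u m := by
  have : Nonempty I := hI.to_subtype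
  obtain ⟨u, hu, ht⟩ := Filter.exists_seq_monotone_tendsto_atTop_atTop I
  refine ⟨u, hu, fun p hp => ?_⟩
  obtain ⟨m, hm⟩ := (ht.eventually (Filter.eventually_ge_atTop ⟨p, hp⟩)).exists
  exact ⟨m, hm⟩

theorem exists_antitone_coinitial {I : Set unitInterval} [I.OrdConnected] (hI : I.Nonempty) :
    ∃ u : ℕ → I, Antitone u ∧ ∀ p ∈ I, ∃ m, u m ≤ p := by
  have : Nonempty I := hI.to_subtype
  obtain ⟨u, hu, ht⟩ := Filter.exists_seq_antitone_tendsto_atTop_atBot I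
  refine ⟨u, hu, fun p hp => ?_⟩
  obtain ⟨m, hm⟩ := (ht.eventually (Filter.eventually_le_atBot ⟨p, hp⟩)).exists
  exact ⟨m, hm⟩

theorem integrable_of_abs_le {f : X → ℝ} (hf : Measurable f) {b : ℝ} (hb : ∀ x, |f x| ≤ b) :
    Integrable f μ :=
  Integrable.of_bound hf.aestronglyMeasurable b (Filter.Eventually.of_forall hb)

/-- On an interval of parameters where the means of a monotone family differ by at most `r`, the
oscillation of the family is dominated by a function with mean at most `r`. -/
theorem exists_dominating {Ψ : unitInterval → X → ℝ} (hmeas : ∀ t, Measurable (Ψ t))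
    (hmono : ∀ x, Monotone fun t => Ψ t x) {b : ℝ} (hΨ : ∀ t x, Ψ t x ∈ Set.Icc 0 b)
    {I : Set unitInterval} [I.OrdConnected] {r : ℝ} (hr : 0 ≤ r)
    (hI : ∀ t ∈ I, ∀ u ∈ I, ∫ x, Ψ u x ∂μ - ∫ x, Ψ t x ∂μ ≤ r) :
    ∃ w : X → ℝ, Measurable w ∧ (∀ x, 0 ≤ w x) ∧ (∀ x, w x ≤ b) ∧ ∫ x, w x ∂μ ≤ r ∧
      ∀ t ∈ I, ∀ u ∈ I, ∀ x, |Ψ t x - Ψ u x| ≤ w x := by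
  obtain ⟨x₀⟩ : Nonempty X := nonempty_of_isProbabilityMeasure μ
  have hb : 0 ≤ b := (hΨ 0 x₀).1.trans (hΨ 0 x₀).2
  rcases I.eq_empty_or_nonempty with rfl | hne
  · exact ⟨fun _ => 0, measurable_const, fun _ => le_rfl, fun _ => hb, by simpa using hr, by simp⟩
  obtain ⟨u, hu, hu'⟩ := exists_monotone_cofinal hne
  obtain ⟨l, hl, hl'⟩ := exists_antitone_coinitial hne
  -- `I` need not contain its endpoints, so the oscillation is taken along sequences tending to both
  -- ends. A countable supremum keeps it measurable, and dominated convergence carries over the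
  -- bound on the mean.
  let d : ℕ → X → ℝ := fun m x => Ψ (u m) x - Ψ (l m) x
  have hdle : ∀ m x, d m x ≤ b := fun m x => by
    have h1 := (hΨ (u m) x).2
    have h2 := (hΨ (l m) x).1
    simp only [d]
    linarith
  have hdge : ∀ m x, -b ≤ d m x := fun m x => by
    have h1 := (hΨ (u m) x).1
    have h2 := (hΨ (l m) x).2
    simp only [d]
    linarith
  have hdm : ∀ m, Measurable (d m) := fun m => (hmeas _).sub (hmeas _)
  have hbdd : ∀ x, BddAbove (Set.range fun m => d m x) := fun x =>
    ⟨b, by rintro _ ⟨m, rfl⟩; exact hdle m x⟩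
  have hdmono : ∀ x, Monotone fun m => d m x := fun x m m' h =>
    sub_le_sub (hmono x (hu h)) (hmono x (hl h))
  have hdom : ∀ t ∈ I, ∀ s ∈ I, ∀ x, |Ψ t x - Ψ s x| ≤ ⨆ m, d m x := by
    intro t ht s hs x
    obtain ⟨m₁, h₁⟩ := hu' t ht
    obtain ⟨m₂, h₂⟩ := hu' s hs
    obtain ⟨m₃, h₃⟩ := hl' t ht
    obtain ⟨m₄, h₄⟩ := hl' s hs
    let m := max (max m₁ m₂) (max m₃ m₄)
    refine le_trans ?_ (le_ciSup (hbdd x) m)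
    have e₁ : Ψ t x ≤ Ψ (u m) x := hmono x (h₁.trans (hu (by simp [m])))
    have e₂ : Ψ s x ≤ Ψ (u m) x := hmono x (h₂.trans (hu (by simp [m])))
    have e₃ : Ψ (l m) x ≤ Ψ t x := hmono x (le_trans (hl (by simp [m])) h₃)
    have e₄ : Ψ (l m) x ≤ Ψ s x := hmono x (le_trans (hl (by simp [m])) h₄)
    rw [abs_le]
    constructor <;> simp only [d] <;> linarith
  refine ⟨fun x => ⨆ m, d m x, Measurable.iSup hdm, fun x => ?_, fun x => ciSup_le fun m => hdle m x,
    ?_, hdom⟩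
  · obtain ⟨t, ht⟩ := hne
    exact (abs_nonneg _).trans (hdom t ht t ht x)
  · have hlim := tendsto_integral_of_dominated_convergence (μ := μ) (F := d)
      (f := fun x => ⨆ m, d m x) (fun _ => b) (fun m => (hdm m).aestronglyMeasurable)
      (integrable_const b)
      (fun m => Filter.Eventually.of_forall fun x => abs_le.2 ⟨hdge m x, hdle m x⟩)
      (Filter.Eventually.of_forall fun x => tendsto_atTop_ciSup (hdmono x) (hbdd x))
    refine le_of_tendsto' hlim fun m => ?_
    have hint : ∀ t, Integrable (Ψ t) μ := fun t =>
      integrable_of_abs_le μ (hmeas t) fun x => by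
        rw [abs_of_nonneg (hΨ t x).1]
        exact (hΨ t x).2
    simp only [d]
    rw [integral_sub (hint _) (hint _)]
    exact hI _ (l m).2 _ (u m).2

/-- The parameters of a monotone family split into `K + 1` cells with small oscillation. -/
theorem exists_cells {Ψ : unitInterval → X → ℝ} (hmeas : ∀ t, Measurable (Ψ t))
    (hmono : ∀ x, Monotone fun t => Ψ t x) (hΨ : ∀ t x, Ψ t x ∈ Set.Icc (0 : ℝ) 2) {K : ℕ}
    (hK : 0 < K) :
    ∃ (cell : unitInterval → Fin (K + 1)) (w : Fin (K + 1) → X → ℝ),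
      (∀ a, Measurable (w a)) ∧ (∀ a x, 0 ≤ w a x) ∧ (∀ a x, w a x ≤ 2) ∧
      (∀ a, ∫ x, w a x ∂μ ≤ 2 / K) ∧
      ∀ t u, cell t = cell u → ∀ x, |Ψ t x - Ψ u x| ≤ w (cell t) x := by
  have hK' : (0 : ℝ) < K := by exact_mod_cast hK
  have hint : ∀ t, Integrable (Ψ t) μ := fun t =>
    integrable_of_abs_le μ (hmeas t) fun x => by
      rw [abs_of_nonneg (hΨ t x).1]
      exact (hΨ t x).2
  let Φ : unitInterval → ℝ := fun t => ∫ x, Ψ t x ∂μ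
  have hΦ0 : ∀ t, 0 ≤ Φ t := fun t => integral_nonneg fun x => (hΨ t x).1
  have hΦ2 : ∀ t, Φ t ≤ 2 := fun t => by
    have := integral_mono (hint t) (integrable_const 2) fun x => (hΨ t x).2
    simpa using this
  have hΦm : Monotone Φ := fun t u htu => integral_mono (hint t) (hint u) fun x => hmono x htu
  -- The mean `Φ` is monotone with values in [0, 2]. Rounding it down to multiples of 2/K gives
  -- levels 0 to K, whose preimages are intervals.
  let lev : unitInterval → ℕ := fun t => ⌊K / 2 * Φ t⌋₊
  have hlev : Monotone lev := fun t u htu =>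
    Nat.floor_mono (mul_le_mul_of_nonneg_left (hΦm htu) (by positivity))
  have hlevK : ∀ t, lev t < K + 1 := fun t => by
    refine Nat.lt_succ_of_le (Nat.floor_le_of_le ?_)
    nlinarith [hΦ2 t]
  have hex : ∀ a : Fin (K + 1), ∃ w : X → ℝ, Measurable w ∧ (∀ x, 0 ≤ w x) ∧ (∀ x, w x ≤ 2) ∧
      ∫ x, w x ∂μ ≤ 2 / K ∧
      ∀ t ∈ lev ⁻¹' {(a : ℕ)}, ∀ u ∈ lev ⁻¹' {(a : ℕ)}, ∀ x, |Ψ t x - Ψ u x| ≤ w x := by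
    intro a
    have : (lev ⁻¹' {(a : ℕ)}).OrdConnected :=
      Set.OrdConnected.preimage_mono Set.ordConnected_singleton hlev
    refine exists_dominating μ hmeas hmono hΨ (by positivity) fun t ht u hu => ?_
    have ht' : lev t = a := ht
    have hu' : lev u = a := hu
    have h1 : (a : ℝ) ≤ K / 2 * Φ t := by
      rw [← ht']
      exact Nat.floor_le (mul_nonneg (by positivity) (hΦ0 t))
    have h2 : K / 2 * Φ u < a + 1 := by
      rw [← hu']
      exact Nat.lt_floor_add_one _
    rw [le_div_iff₀ hK']
    change (Φ u - Φ t) * K ≤ 2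
    nlinarith
  choose w hw using hex
  exact ⟨fun t => ⟨lev t, hlevK t⟩, w, fun a => (hw a).1, fun a => (hw a).2.1,
    fun a => (hw a).2.2.1, fun a => (hw a).2.2.2.1, fun t u h x =>
      (hw ⟨lev t, hlevK t⟩).2.2.2.2 t rfl u (Fin.mk_eq_mk.1 h).symm x⟩

/-- A family that is dominated by a sum of monotone families splits into finitely many cells with
small oscillation. -/
theorem exists_product_cells {B : Type*} [Fintype B] {Ψ : B → unitInterval → X → ℝ}
    (hmeas : ∀ β t, Measurable (Ψ β t)) (hmono : ∀ β x, Monotone fun t => Ψ β t x)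
    (hΨ : ∀ β t x, Ψ β t x ∈ Set.Icc (0 : ℝ) 2) {F : (B → unitInterval) → X → ℝ}
    (hF : ∀ θ x, F θ x ∈ Set.Icc (0 : ℝ) 1)
    (hdom : ∀ θ θ' x, |F θ x - F θ' x| ≤ ∑ β, |Ψ β (θ β) x - Ψ β (θ' β) x|) {K : ℕ} (hK : 0 < K) :
    ∃ (cell : (B → unitInterval) → B → Fin (K + 1)) (w : (B → Fin (K + 1)) → X → ℝ),
      (∀ a, Measurable (w a)) ∧ (∀ a x, 0 ≤ w a x) ∧ (∀ a x, w a x ≤ 1) ∧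
      (∀ a, ∫ x, w a x ∂μ ≤ 2 * Fintype.card B / K) ∧
      ∀ θ θ', cell θ = cell θ' → ∀ x, |F θ x - F θ' x| ≤ w (cell θ) x := by
  choose cell w h1 h2 h3 h4 h5 using fun β => exists_cells μ (hmeas β) (hmono β) (hΨ β) hK
  have hint : ∀ β a, Integrable (w β a) μ := fun β a =>
    integrable_of_abs_le μ (h1 β a) fun x => by
      rw [abs_of_nonneg (h2 β a x)]
      exact h3 β a x
  have hmeas' : ∀ a : B → Fin (K + 1), Measurable fun x => ∑ β, w β (a β) x := fun a =>
    Finset.measurable_sum _ fun β _ => h1 β (a β)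
  have hnn : ∀ (a : B → Fin (K + 1)) x, 0 ≤ ∑ β, w β (a β) x := fun a x =>
    Finset.sum_nonneg fun β _ => h2 β (a β) x
  -- Truncation at 1 loses nothing because `F` has values in [0, 1], and it provides the uniform
  -- bound that Bernstein's inequality needs.
  refine ⟨fun θ β => cell β (θ β), fun a x => min 1 (∑ β, w β (a β) x),
    fun a => measurable_const.min (hmeas' a), fun a x => le_min zero_le_one (hnn a x),
    fun a x => min_le_left _ _, fun a => ?_, fun θ θ' h x => le_min ?_ ?_⟩
  · calc ∫ x, min 1 (∑ β, w β (a β) x) ∂μ ≤ ∫ x, ∑ β, w β (a β) x ∂μ := by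
          refine integral_mono (integrable_of_abs_le μ (measurable_const.min (hmeas' a)) (b := 1)
            fun x => ?_) (integrable_finsetSum _ fun β _ => hint β (a β)) fun x => min_le_right _ _
          rw [abs_of_nonneg (le_min zero_le_one (hnn a x))]
          exact min_le_left _ _
      _ = ∑ β, ∫ x, w β (a β) x ∂μ := integral_finsetSum _ fun β _ => hint β (a β)
      _ ≤ ∑ _β : B, (2 : ℝ) / K := Finset.sum_le_sum fun β _ => h4 β (a β)
      _ = 2 * Fintype.card B / K := by
          rw [Finset.sum_const, Finset.card_univ, nsmul_eq_mul]
          ring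
  · have e1 := hF θ x
    have e2 := hF θ' x
    rw [abs_le]
    constructor <;> linarith [e1.1, e1.2, e2.1, e2.2]
  · exact (hdom θ θ' x).trans (Finset.sum_le_sum fun β _ => h5 β _ _ (congrFun h β) x)

end Cells

/-! ### Bernstein's inequality and union bound -/

section Concentration

variable {X : Type*} [MeasurableSpace X] (μ : Measure X) [IsProbabilityMeasure μ]

/-- The deviation of the empirical mean of `f` from its expectation. -/
def deviation {T : ℕ} (f : X → ℝ) (x : Fin T → X) : ℝ :=
  (1 / (T : ℝ)) * ∑ t, f (x t) - ∫ y, f y ∂μ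

/-- From e^u ≤ 1 + u + u² for |u| ≤ 1, the moment generating function is at most 1 + l² Var g, and
Var g ≤ E g² ≤ E|g| because |g| ≤ 1. The centered function is at most 2 in absolute value, hence the
condition l ≤ 1/2. -/
theorem integral_exp_centered_le {g : X → ℝ} (hg : Measurable g) (hb : ∀ x, |g x| ≤ 1) {s l : ℝ}
    (hs : ∫ x, |g x| ∂μ ≤ s) (hl : 0 ≤ l) (hl2 : l ≤ 1 / 2) :
    ∫ x, Real.exp (l * (g x - ∫ y, g y ∂μ)) ∂μ ≤ Real.exp (l ^ 2 * s) := by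
  set m := ∫ y, g y ∂μ with hm
  have hgi : Integrable g μ := integrable_of_abs_le μ hg hb
  have hm1 : |m| ≤ 1 := by
    refine (abs_integral_le_integral_abs).trans ?_
    have := integral_mono hgi.abs (integrable_const 1) hb
    simpa using this
  have hle : ∀ x, |l * (g x - m)| ≤ 1 := fun x => by
    rw [abs_mul, abs_of_nonneg hl]
    have : |g x - m| ≤ 2 := (abs_sub _ _).trans (by linarith [hb x])
    nlinarith [abs_nonneg (g x - m)]
  have hsq : Integrable (fun x => g x ^ 2) μ :=
    integrable_of_abs_le μ (hg.pow_const 2) (b := 1) fun x => by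
      rw [abs_pow]
      exact pow_le_one₀ (abs_nonneg _) (hb x)
  have hpt : ∀ x, Real.exp (l * (g x - m)) ≤
      (1 - l * m + l ^ 2 * m ^ 2) + (l - 2 * l ^ 2 * m) * g x + l ^ 2 * g x ^ 2 := fun x => by
    have := (abs_le.1 (Real.abs_exp_sub_one_sub_id_le (hle x))).2
    nlinarith
  have hexpm : Measurable fun x => Real.exp (l * (g x - m)) :=
    Real.measurable_exp.comp (measurable_const.mul (hg.sub_const m))
  have hexpi : Integrable (fun x => Real.exp (l * (g x - m))) μ :=
    integrable_of_abs_le μ hexpm (b := Real.exp 1) fun x => by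
      rw [abs_of_pos (Real.exp_pos _)]
      exact Real.exp_le_exp.2 ((le_abs_self _).trans (hle x))
  have hsqle : ∫ x, g x ^ 2 ∂μ ≤ s := by
    refine (integral_mono hsq hgi.abs fun x => ?_).trans hs
    simp only
    rw [← sq_abs]
    nlinarith [hb x, abs_nonneg (g x)]
  have hlin : Integrable (fun x => (1 - l * m + l ^ 2 * m ^ 2) + (l - 2 * l ^ 2 * m) * g x) μ :=
    (integrable_const _).add (hgi.const_mul _)
  calc ∫ x, Real.exp (l * (g x - m)) ∂μ
      ≤ ∫ x, ((1 - l * m + l ^ 2 * m ^ 2) + (l - 2 * l ^ 2 * m) * g x + l ^ 2 * g x ^ 2) ∂μ :=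
        integral_mono hexpi (hlin.add (hsq.const_mul _)) hpt
    _ = (1 - l * m + l ^ 2 * m ^ 2) + (l - 2 * l ^ 2 * m) * m + l ^ 2 * ∫ x, g x ^ 2 ∂μ := by
        rw [integral_add hlin (hsq.const_mul _),
          integral_add (integrable_const _) (hgi.const_mul _), integral_const_mul,
          integral_const_mul, integral_const]
        simp [hm]
    _ ≤ l ^ 2 * s + 1 := by nlinarith [sq_nonneg (l * m), sq_nonneg l]
    _ ≤ Real.exp (l ^ 2 * s) := Real.add_one_le_exp _

/-- A one-sided Bernstein inequality for bounded functions of small mean absolute value. -/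
theorem measure_sum_centered_ge_le {T : ℕ} {g : X → ℝ} (hg : Measurable g)
    (hb : ∀ x, |g x| ≤ 1) {s t : ℝ} (hs : ∫ x, |g x| ∂μ ≤ s) (ht : 0 < t) (hts : t ≤ s) :
    (Measure.pi fun _ : Fin T => μ) {x | T * t ≤ ∑ i, (g (x i) - ∫ y, g y ∂μ)} ≤
      ENNReal.ofReal (Real.exp (-(T * t ^ 2 / (4 * s)))) := by
  have hs0 : 0 < s := ht.trans_le hts
  set m := ∫ y, g y ∂μ with hm
  -- The minimizer of l² s - l t, with minimum -t²/(4s); `t ≤ s` makes it at most 1/2.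
  set l := t / (2 * s) with hl
  have hl0 : 0 ≤ l := by positivity
  have hl2 : l ≤ 1 / 2 := by
    rw [hl, div_le_div_iff₀ (by positivity) (by norm_num)]
    linarith
  let Y : (Fin T → X) → ℝ := fun x => ∑ i, (g (x i) - m)
  have hYm : Measurable Y :=
    Finset.measurable_sum _ fun i _ => (hg.comp (measurable_pi_apply i)).sub_const m
  have hm1 : |m| ≤ 1 := by
    refine (abs_integral_le_integral_abs).trans ?_
    have := integral_mono (integrable_of_abs_le μ hg hb).abs (integrable_const 1) hb
    simpa using this
  have hYle : ∀ x, Y x ≤ T * 2 := fun x => by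
    refine (Finset.sum_le_sum (g := fun _ => (2 : ℝ)) fun i _ => ?_).trans (by simp)
    linarith [(abs_le.1 (hb (x i))).2, (abs_le.1 hm1).1]
  have hint : Integrable (fun x => Real.exp (l * Y x)) (Measure.pi fun _ : Fin T => μ) :=
    integrable_of_abs_le _ (Real.measurable_exp.comp (measurable_const.mul hYm))
      (b := Real.exp (l * (T * 2))) fun x => by
      rw [abs_of_pos (Real.exp_pos _)]
      exact Real.exp_le_exp.2 (mul_le_mul_of_nonneg_left (hYle x) hl0)
  have hmgf : mgf Y (Measure.pi fun _ : Fin T => μ) l ≤ Real.exp (l ^ 2 * s) ^ T := by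
    have : ∀ x, Real.exp (l * Y x) = ∏ i, Real.exp (l * (g (x i) - m)) := fun x => by
      rw [← Real.exp_sum, ← Finset.mul_sum]
    simp only [mgf, this]
    rw [integral_fintype_prod_eq_pow (fun y => Real.exp (l * (g y - m))), Fintype.card_fin]
    exact pow_le_pow_left₀ (integral_nonneg fun _ => (Real.exp_pos _).le)
      (integral_exp_centered_le μ hg hb hs hl0 hl2) T
  have hch := measure_ge_le_exp_mul_mgf (μ := Measure.pi fun _ : Fin T => μ) (X := Y) (T * t) hl0
    hint
  rw [← ENNReal.ofReal_toReal (measure_ne_top (Measure.pi fun _ : Fin T => μ) _)]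
  refine ENNReal.ofReal_le_ofReal (hch.trans ?_)
  calc Real.exp (-l * (T * t)) * mgf Y (Measure.pi fun _ : Fin T => μ) l
      ≤ Real.exp (-l * (T * t)) * Real.exp (l ^ 2 * s) ^ T := by gcongr
    _ = Real.exp (-(T * t ^ 2 / (4 * s))) := by
        rw [← Real.exp_nat_mul, ← Real.exp_add]
        congr 1
        rw [hl]
        field_simp
        ring

theorem measure_abs_deviation_gt_le {T : ℕ} (hT : 0 < T) {g : X → ℝ} (hg : Measurable g)
    (hb : ∀ x, |g x| ≤ 1) {s t : ℝ} (hs : ∫ x, |g x| ∂μ ≤ s) (ht : 0 < t) (hts : t ≤ s) :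
    (Measure.pi fun _ : Fin T => μ) {x | t < |deviation μ g x|} ≤
      ENNReal.ofReal (2 * Real.exp (-(T * t ^ 2 / (4 * s)))) := by
  have hT' : (0 : ℝ) < T := by exact_mod_cast hT
  have hsum : ∀ (f : X → ℝ) (x : Fin T → X),
      ∑ i, (f (x i) - ∫ y, f y ∂μ) = T * deviation μ f x := fun f x => by
    rw [deviation, Finset.sum_sub_distrib, Finset.sum_const, Finset.card_univ, Fintype.card_fin,
      nsmul_eq_mul]
    field_simp
  have hneg : ∀ x : Fin T → X, deviation μ (fun y => -g y) x = -deviation μ g x := fun x => by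
    rw [deviation, deviation, integral_neg, Finset.sum_neg_distrib]
    ring
  have h1 := measure_sum_centered_ge_le μ (T := T) hg hb hs ht hts
  have h2 := measure_sum_centered_ge_le μ (T := T) hg.neg (fun x => by simpa using hb x)
    (by simpa using hs) ht hts
  simp only [Pi.neg_apply] at h2
  calc (Measure.pi fun _ : Fin T => μ) {x | t < |deviation μ g x|}
      ≤ (Measure.pi fun _ : Fin T => μ) ({x | T * t ≤ ∑ i, (g (x i) - ∫ y, g y ∂μ)} ∪
          {x | T * t ≤ ∑ i, (-g (x i) - ∫ y, -g y ∂μ)}) := by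
        refine measure_mono fun x hx => ?_
        rw [Set.mem_ofPred_eq, lt_abs] at hx
        rcases hx with hx | hx
        · left
          rw [Set.mem_ofPred_eq, hsum]
          exact mul_le_mul_of_nonneg_left hx.le hT'.le
        · right
          rw [Set.mem_ofPred_eq, hsum (fun y => -g y), hneg]
          exact mul_le_mul_of_nonneg_left hx.le hT'.le
    _ ≤ _ := measure_union_le _ _
    _ ≤ _ := add_le_add h1 h2
    _ = _ := by rw [← ENNReal.ofReal_add (Real.exp_pos _).le (Real.exp_pos _).le, two_mul]

theorem measure_exists_abs_deviation_gt_le {ι : Type*} [Fintype ι] {T : ℕ} (hT : 0 < T)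
    {g : ι → X → ℝ} (hg : ∀ i, Measurable (g i)) (hb : ∀ i x, |g i x| ≤ 1) {s t : ℝ}
    (hs : ∀ i, ∫ x, |g i x| ∂μ ≤ s) (ht : 0 < t) (hts : t ≤ s) :
    (Measure.pi fun _ : Fin T => μ) {x | ∃ i, t < |deviation μ (g i) x|} ≤
      ENNReal.ofReal (Fintype.card ι * (2 * Real.exp (-(T * t ^ 2 / (4 * s))))) := by
  rw [Set.ofPred_exists]
  refine (measure_iUnion_fintype_le _ _).trans ?_
  refine (Finset.sum_le_sum fun i _ =>
    measure_abs_deviation_gt_le μ hT (hg i) (hb i) (hs i) ht hts).trans ?_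
  rw [Finset.sum_const, Finset.card_univ, nsmul_eq_mul,
    ENNReal.ofReal_mul (Nat.cast_nonneg _), ENNReal.ofReal_natCast]

end Concentration

/-! ### Additivity and domination of deviations -/

section Deviation

variable {X : Type*} [MeasurableSpace X] (μ : Measure X)

theorem deviation_add {T : ℕ} {f g : X → ℝ} (hf : Integrable f μ) (hg : Integrable g μ)
    (x : Fin T → X) :
    deviation μ (fun y => f y + g y) x = deviation μ f x + deviation μ g x := by
  simp only [deviation]
  rw [integral_add hf hg, Finset.sum_add_distrib]
  ring

/-- The empirical mean of `w` is its deviation plus its integral; the second integral bounds the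
difference of the expectations. -/
theorem abs_deviation_le_of_abs_sub_le {T : ℕ} {f g w : X → ℝ} (hf : Integrable f μ)
    (hg : Integrable g μ) (hw : Integrable w μ) (h : ∀ y, |f y - g y| ≤ w y) (x : Fin T → X) :
    |deviation μ f x - deviation μ g x| ≤ deviation μ w x + 2 * ∫ y, w y ∂μ := by
  have h1 : deviation μ f x - deviation μ g x =
      (1 / (T : ℝ)) * ∑ t, (f (x t) - g (x t)) - ∫ y, (f y - g y) ∂μ := by
    simp only [deviation]
    rw [integral_sub hf hg, Finset.sum_sub_distrib]
    ring
  have h2 : |∫ y, (f y - g y) ∂μ| ≤ ∫ y, w y ∂μ :=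
    abs_integral_le_integral_abs.trans (integral_mono (hf.sub hg).abs hw h)
  have h3 : |(1 / (T : ℝ)) * ∑ t, (f (x t) - g (x t))| ≤ (1 / (T : ℝ)) * ∑ t, w (x t) := by
    rw [abs_mul, abs_of_nonneg (by positivity : (0 : ℝ) ≤ 1 / T)]
    exact mul_le_mul_of_nonneg_left ((Finset.abs_sum_le_sum_abs _ _).trans
      (Finset.sum_le_sum fun t _ => h _)) (by positivity)
  rw [h1]
  refine (abs_sub _ _).trans ?_
  simp only [deviation]
  linarith

end Deviation

/-! ### Chaining along partitions -/

section Chaining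

variable {X Θ : Type*} [Nonempty Θ]

open Classical in
/-- A parameter in the given cell, if there is one. -/
def cellRep {κ : Type*} (cell : Θ → κ) (c : κ) : Θ :=
  if h : ∃ θ, cell θ = c then h.choose else Classical.arbitrary Θ

theorem cell_cellRep {κ : Type*} (cell : Θ → κ) (θ : Θ) :
    cell (cellRep cell (cell θ)) = cell θ := by
  have h : ∃ θ', cell θ' = cell θ := ⟨θ, rfl⟩
  rw [cellRep, dif_pos h]
  exact h.choose_spec

variable {ι : ℕ → Type*}

open Classical in
/-- The increment between the representatives of two cells at consecutive levels that have a
common member; at the lowest level, the representative itself. -/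
def chainLink (F : Θ → X → ℝ) (cell : ∀ j, Θ → ι j) (j : ℕ) (a : ι j × ι (j - 1)) : X → ℝ :=
  -- Partitions of different levels need not be nested, so all pairs of cells are indexed. Disjoint
  -- pairs get the zero function, which keeps the mean bound valid for every index.
  if ∃ θ, cell j θ = a.1 ∧ cell (j - 1) θ = a.2 then
    fun x => F (cellRep (cell j) a.1) x - if j = 0 then 0 else F (cellRep (cell (j - 1)) a.2) x
  else fun _ => 0

variable {F : Θ → X → ℝ} {cell : ∀ j, Θ → ι j}

theorem chainLink_apply (j : ℕ) (θ : Θ) (x : X) :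
    chainLink F cell j (cell j θ, cell (j - 1) θ) x = F (cellRep (cell j) (cell j θ)) x -
      if j = 0 then 0 else F (cellRep (cell (j - 1)) (cell (j - 1) θ)) x := by
  rw [chainLink, if_pos ⟨θ, rfl, rfl⟩]

theorem abs_chainLink_le_one (hF : ∀ θ x, F θ x ∈ Set.Icc (0 : ℝ) 1) (j : ℕ)
    (a : ι j × ι (j - 1)) (x : X) : |chainLink F cell j a x| ≤ 1 := by
  rw [chainLink]
  have h1 := hF (cellRep (cell j) a.1) x
  have h2 := hF (cellRep (cell (j - 1)) a.2) x
  split_ifs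
  · rw [abs_le]
    constructor <;> linarith [h1.1, h1.2]
  · rw [abs_le]
    constructor <;> linarith [h1.1, h1.2, h2.1, h2.2]
  · simp

variable {w : ∀ j, ι j → X → ℝ} [MeasurableSpace X]

theorem measurable_chainLink (hFm : ∀ θ, Measurable (F θ)) (j : ℕ) (a : ι j × ι (j - 1)) :
    Measurable (chainLink F cell j a) := by
  rw [chainLink]
  split_ifs
  · exact (hFm _).sub measurable_const
  · exact (hFm _).sub (hFm _)
  · exact measurable_const

variable (μ : Measure X) [IsProbabilityMeasure μ]

/-- A common member of the two cells is within the two brackets of their representatives, and 4^(-j)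
+ 4^(-(j-1)) = 5/4^j. At level 0 the trivial bound 1 suffices. -/
theorem integral_abs_chainLink_le (hFm : ∀ θ, Measurable (F θ))
    (hF : ∀ θ x, F θ x ∈ Set.Icc (0 : ℝ) 1) (hwi : ∀ j c, Integrable (w j c) μ)
    (hwμ : ∀ j c, ∫ x, w j c x ∂μ ≤ 1 / 4 ^ j)
    (hcell : ∀ j θ θ', cell j θ = cell j θ' → ∀ x, |F θ x - F θ' x| ≤ w j (cell j θ) x)
    (j : ℕ) (a : ι j × ι (j - 1)) : ∫ x, |chainLink F cell j a x| ∂μ ≤ 5 / 4 ^ j := by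
  have hint : Integrable (chainLink F cell j a) μ :=
    integrable_of_abs_le μ (measurable_chainLink hFm j a) (abs_chainLink_le_one hF j a)
  by_cases hex : ∃ θ, cell j θ = a.1 ∧ cell (j - 1) θ = a.2
  · obtain ⟨θ, h1, h2⟩ := hex
    obtain ⟨a₁, a₂⟩ := a
    subst h1 h2
    rcases Nat.eq_zero_or_pos j with rfl | hj
    · have := integral_mono hint.abs (integrable_const 1) (abs_chainLink_le_one hF 0 _)
      simp only [integral_const, probReal_univ, smul_eq_mul, mul_one] at this
      norm_num
      linarith
    · have hpow : (4 : ℝ) ^ j = 4 * 4 ^ (j - 1) := by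
        rw [← pow_succ', Nat.sub_add_cancel hj]
      have hle : ∀ x, |chainLink F cell j (cell j θ, cell (j - 1) θ) x| ≤
          w j (cell j θ) x + w (j - 1) (cell (j - 1) θ) x := fun x => by
        rw [chainLink_apply, if_neg hj.ne']
        have e1 := hcell j θ _ (cell_cellRep (cell j) θ).symm x
        have e2 := hcell (j - 1) θ _ (cell_cellRep (cell (j - 1)) θ).symm x
        rw [abs_le] at e1 e2 ⊢
        constructor <;> linarith [e1.1, e1.2, e2.1, e2.2]
      refine (integral_mono hint.abs ((hwi _ _).add (hwi _ _)) hle).trans ?_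
      rw [integral_add' (hwi _ _) (hwi _ _)]
      have e1 := hwμ j (cell j θ)
      have e2 := hwμ (j - 1) (cell (j - 1) θ)
      have e3 : (5 : ℝ) / 4 ^ j = 1 / 4 ^ j + 1 / 4 ^ (j - 1) := by
        rw [hpow]
        field_simp
        norm_num
      linarith
  · rw [chainLink, if_neg hex]
    simp only [abs_zero, integral_zero]
    positivity

theorem sum_range_succ_div_two_pow (m : ℕ) :
    ∑ j ∈ Finset.range m, ((j : ℝ) + 1) / 2 ^ j = 4 - (m + 2) * 2 / 2 ^ m := by
  induction m with
  | zero => norm_num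
  | succ m ih =>
    rw [Finset.sum_range_succ, ih, pow_succ]
    push_cast
    field_simp
    ring

/-- The error budget: the links contribute at most 4 · ε/32 = ε/8, and the last bracket contributes
its deviation, at most ε/32, plus twice its mean, at most 2 · ε/8. The total is below ε/2. -/
theorem abs_deviation_le_of_chain (hFm : ∀ θ, Measurable (F θ))
    (hF : ∀ θ x, F θ x ∈ Set.Icc (0 : ℝ) 1) (hwi : ∀ j c, Integrable (w j c) μ)
    (hwμ : ∀ j c, ∫ x, w j c x ∂μ ≤ 1 / 4 ^ j)
    (hcell : ∀ j θ θ', cell j θ = cell j θ' → ∀ x, |F θ x - F θ' x| ≤ w j (cell j θ) x)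
    {T : ℕ} {x : Fin T → X} {ε : ℝ} (hε : 0 < ε) {J : ℕ} (hJ : 8 / ε ≤ 4 ^ J)
    (hlink : ∀ j ≤ J, ∀ a, |deviation μ (chainLink F cell j a) x| ≤ ε * (j + 1) / (32 * 2 ^ j))
    (hw : ∀ c, |deviation μ (w J c) x| ≤ ε * (J + 1) / (32 * 2 ^ J)) (θ : Θ) :
    |deviation μ (F θ) x| ≤ ε / 2 := by
  have hFi : ∀ θ, Integrable (F θ) μ := fun θ =>
    integrable_of_abs_le μ (hFm θ) (b := 1) fun x => by
      rw [abs_of_nonneg (hF θ x).1]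
      exact (hF θ x).2
  let f : ℕ → X → ℝ := fun j => F (cellRep (cell j) (cell j θ))
  have hsum : ∀ j ≤ J, |deviation μ (f j) x| ≤
      ε / 32 * ∑ i ∈ Finset.range (j + 1), ((i : ℝ) + 1) / 2 ^ i := by
    intro j
    induction j with
    | zero =>
      intro h
      have h1 := hlink 0 h (cell 0 θ, cell 0 θ)
      have h2 : chainLink F cell 0 (cell 0 θ, cell 0 θ) = f 0 := by
        funext y
        have := chainLink_apply (F := F) (cell := cell) 0 θ y
        simpa [f] using this
      rw [h2] at h1
      refine h1.trans (le_of_eq ?_)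
      simp
    | succ j ih =>
      intro h
      have h1 := hlink (j + 1) h (cell (j + 1) θ, cell j θ)
      have h2 : f (j + 1) = fun y =>
          f j y + chainLink F cell (j + 1) (cell (j + 1) θ, cell j θ) y := by
        funext y
        have : chainLink F cell (j + 1) (cell (j + 1) θ, cell j θ) y = f (j + 1) y - f j y := by
          have := chainLink_apply (F := F) (cell := cell) (j + 1) θ y
          rwa [if_neg (Nat.succ_ne_zero j)] at this
        rw [this, add_sub_cancel]
      have hi : Integrable (chainLink F cell (j + 1) (cell (j + 1) θ, cell j θ)) μ :=
        integrable_of_abs_le μ (measurable_chainLink hFm (j + 1) _)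
          (abs_chainLink_le_one hF (j + 1) _)
      rw [h2, deviation_add μ (hFi _) hi, Finset.sum_range_succ, mul_add]
      refine (abs_add_le _ _).trans (add_le_add (ih (by omega)) (h1.trans (le_of_eq ?_)))
      field_simp
  have h4 := hsum J le_rfl
  rw [sum_range_succ_div_two_pow] at h4
  have h5 : (0 : ℝ) ≤ ((J + 1 : ℕ) + 2) * 2 / 2 ^ (J + 1) := by positivity
  have h6 := abs_deviation_le_of_abs_sub_le μ (hFi θ) (hFi (cellRep (cell J) (cell J θ)))
    (hwi J (cell J θ)) (hcell J θ _ (cell_cellRep (cell J) θ).symm) x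
  have h7 := (le_abs_self _).trans (hw (cell J θ))
  have h8 := hwμ J (cell J θ)
  have h9 : 1 / (4 : ℝ) ^ J ≤ ε / 8 := by
    rw [div_le_iff₀ hε] at hJ
    rw [div_le_div_iff₀ (by positivity) (by norm_num)]
    linarith
  have h10 : ε * (J + 1) / (32 * 2 ^ J) ≤ ε / 32 := by
    have : (J : ℝ) + 1 ≤ 2 ^ J := by exact_mod_cast Nat.lt_two_pow_self
    rw [div_le_div_iff₀ (by positivity) (by norm_num)]
    nlinarith
  have h11 : |deviation μ (f J) x| ≤ ε / 8 := by nlinarith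
  have h12 : |deviation μ (F θ) x| ≤ |deviation μ (f J) x| +
      |deviation μ (F θ) x - deviation μ (f J) x| := by
    have := abs_add_le (deviation μ (f J) x) (deviation μ (F θ) x - deviation μ (f J) x)
    rwa [add_sub_cancel] at this
  have h13 : |deviation μ (F θ) x - deviation μ (f J) x| ≤
    deviation μ (w J (cell J θ)) x + 2 * ∫ y, w J (cell J θ) y ∂μ := h6
  linarith

/-- A uniform deviation inequality by chaining along partitions into cells of decreasing
oscillation. -/
theorem measure_exists_deviation_gt_le [∀ j, Fintype (ι j)] (hFm : ∀ θ, Measurable (F θ))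
    (hF : ∀ θ x, F θ x ∈ Set.Icc (0 : ℝ) 1) (hwm : ∀ j c, Measurable (w j c))
    (hw0 : ∀ j c x, 0 ≤ w j c x) (hw1 : ∀ j c x, w j c x ≤ 1)
    (hwμ : ∀ j c, ∫ x, w j c x ∂μ ≤ 1 / 4 ^ j)
    (hcell : ∀ j θ θ', cell j θ = cell j θ' → ∀ x, |F θ x - F θ' x| ≤ w j (cell j θ) x)
    {N : ℕ → ℝ} (hN : ∀ j, (Fintype.card (ι j) : ℝ) ≤ N j) (hNmono : Monotone N)
    (hN1 : ∀ j, 1 ≤ N j)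
    {T : ℕ} (hT : 0 < T) {ε δ : ℝ} (hε : 0 < ε) (hε1 : ε < 1) (hδ : 0 < δ)
    (hsize : ∀ j : ℕ, 4 * N j ^ 2 * Real.exp (-(T * ε ^ 2 * (j + 1) ^ 2 / 20480)) ≤
      δ / 2 ^ (j + 1)) :
    (Measure.pi fun _ : Fin T => μ) {x | ∃ θ, ε / 2 < |deviation μ (F θ) x|} ≤
      ENNReal.ofReal δ := by
  have hwabs : ∀ j c x, |w j c x| ≤ 1 := fun j c x => by
    rw [abs_of_nonneg (hw0 j c x)]
    exact hw1 j c x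
  have hwi : ∀ j c, Integrable (w j c) μ := fun j c => integrable_of_abs_le μ (hwm j c) (hwabs j c)
  -- The depth has 4^J > 8/ε, so that the last brackets are negligible, but 4^J ≤ 32/ε, so that `t j
  -- ≤ 5 / 4 ^ j` keeps every level in the range of the Bernstein bound.
  obtain ⟨J', hJ1, hJ2⟩ := exists_nat_pow_near (x := 8 / ε) (y := (4 : ℝ))
    (by rw [le_div_iff₀ hε]; linarith) (by norm_num)
  let J := J' + 1
  have hJlow : 8 / ε ≤ 4 ^ J := hJ2.le
  have hJup : ε * 4 ^ J ≤ 32 := by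
    rw [le_div_iff₀ hε] at hJ1
    simp only [J, pow_succ]
    linarith
  let t : ℕ → ℝ := fun j => ε * (j + 1) / (32 * 2 ^ j)
  have ht0 : ∀ j, 0 < t j := fun j => by positivity
  have hts : ∀ j ≤ J, t j ≤ 5 / 4 ^ j := fun j hj => by
    have h1 : (j : ℝ) + 1 ≤ 2 ^ j := by exact_mod_cast Nat.lt_two_pow_self
    have h2 : (4 : ℝ) ^ j = 2 ^ j * 2 ^ j := by rw [← mul_pow]; norm_num
    have h3 : (4 : ℝ) ^ j ≤ 4 ^ J := pow_le_pow_right₀ (by norm_num) hj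
    rw [div_le_div_iff₀ (by positivity) (by positivity)]
    have h4 : ε * 4 ^ j ≤ 32 := (mul_le_mul_of_nonneg_left h3 hε.le).trans hJup
    have h5 : ε * 4 ^ j * (j + 1) ≤ 32 * 2 ^ j :=
      mul_le_mul h4 h1 (by positivity) (by norm_num)
    nlinarith
  have hexp : ∀ j : ℕ, T * t j ^ 2 / (4 * (5 / 4 ^ j)) = T * ε ^ 2 * (j + 1) ^ 2 / 20480 := by
    intro j
    have h2 : (4 : ℝ) ^ j = 2 ^ j * 2 ^ j := by rw [← mul_pow]; norm_num
    simp only [t]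
    rw [h2]
    field_simp
    norm_num
  let bad : ℕ → Set (Fin T → X) := fun j =>
    {x | ∃ a, t j < |deviation μ (chainLink F cell j a) x|} ∪ {x | ∃ c, t j < |deviation μ (w j c) x|}
  have hbad : ∀ j ≤ J, (Measure.pi fun _ : Fin T => μ) (bad j) ≤
      ENNReal.ofReal (δ / 2 ^ (j + 1)) := by
    intro j hj
    have h1 := measure_exists_abs_deviation_gt_le μ hT
      (measurable_chainLink (cell := cell) hFm j) (abs_chainLink_le_one hF j)
      (integral_abs_chainLink_le μ hFm hF hwi hwμ hcell j) (ht0 j) (hts j hj)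
    have h2 := measure_exists_abs_deviation_gt_le μ hT (hwm j) (hwabs j) (s := 5 / 4 ^ j)
      (fun c => by
        simp only [abs_of_nonneg (hw0 j c _)]
        refine (hwμ j c).trans ?_
        gcongr
        norm_num) (ht0 j) (hts j hj)
    refine (measure_union_le _ _).trans ((add_le_add h1 h2).trans ?_)
    rw [← ENNReal.ofReal_add (by positivity) (by positivity), hexp]
    refine ENNReal.ofReal_le_ofReal (le_trans ?_ (hsize j))
    -- At most N² links and N ≤ N² brackets, each with a two-sided tail: this is the factor 4N² in
    -- `hsize`.
    have e1 : (Fintype.card (ι j × ι (j - 1)) : ℝ) ≤ N j ^ 2 := by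
      rw [Fintype.card_prod, Nat.cast_mul, sq]
      exact mul_le_mul (hN j) ((hN _).trans (hNmono (Nat.sub_le j 1))) (Nat.cast_nonneg _)
        (zero_le_one.trans (hN1 j))
    have e2 : (Fintype.card (ι j) : ℝ) ≤ N j ^ 2 := (hN j).trans (by nlinarith [hN1 j])
    have e3 := Real.exp_pos (-(T * ε ^ 2 * (j + 1) ^ 2 / 20480))
    nlinarith
  have hsub : {x : Fin T → X | ∃ θ, ε / 2 < |deviation μ (F θ) x|} ⊆
      ⋃ j ∈ Finset.range (J + 1), bad j := by
    rintro x ⟨θ, hθ⟩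
    by_contra hx
    simp only [Set.mem_iUnion, not_exists, Finset.mem_range, bad, Set.mem_union, not_or,
      Set.mem_ofPred_eq, not_lt] at hx
    exact absurd hθ (not_lt.2 (abs_deviation_le_of_chain μ hFm hF hwi hwμ hcell hε hJlow
      (fun j hj a => (hx j (Nat.lt_succ_of_le hj)).1 a) (hx J (Nat.lt_succ_self J)).2 θ))
  refine (measure_mono hsub).trans ((measure_biUnion_finset_le _ _).trans ?_)
  refine (Finset.sum_le_sum fun j hj =>
    hbad j (Nat.le_of_lt_succ (Finset.mem_range.1 hj))).trans ?_
  rw [← ENNReal.ofReal_sum_of_nonneg fun j _ => by positivity]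
  refine ENNReal.ofReal_le_ofReal ?_
  have hgeo : ∀ m : ℕ, ∑ j ∈ Finset.range m, δ / 2 ^ (j + 1) = δ - δ / 2 ^ m := by
    intro m
    induction m with
    | zero => simp
    | succ m ih =>
      rw [Finset.sum_range_succ, ih, pow_succ]
      field_simp
      ring
  rw [hgeo]
  exact sub_le_self _ (by positivity)

end Chaining

/-! ### Uniform convergence over the class -/

section UniformConvergence

variable {n : ℕ}

/-- The logarithm of the union bound grows linearly in j + 1, at most 12L(j + 1), while the exponent
grows quadratically; 12 · 20480 < 500000 settles all levels at once. -/
theorem size_bound {k : ℕ} (hk : 1 ≤ k) {y δ : ℝ} (hδ : 0 < δ) (hδ1 : δ < 1)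
    (hy : 500000 * max 1 (k * Real.log k + Real.log (1 / δ)) ≤ y) (j : ℕ) :
    4 * (((2 * k * 4 ^ j + 1 : ℕ) : ℝ) ^ k) ^ 2 * Real.exp (-(y * (j + 1) ^ 2 / 20480)) ≤
      δ / 2 ^ (j + 1) := by
  have hk' : (1 : ℝ) ≤ k := by exact_mod_cast hk
  set m := max 1 ((k : ℝ) * Real.log k) with hm
  set L := max 1 ((k : ℝ) * Real.log k + Real.log (1 / δ)) with hL
  have hkl : 0 ≤ (k : ℝ) * Real.log k := mul_nonneg (by positivity) (Real.log_nonneg hk')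
  have hlδ : 0 ≤ Real.log (1 / δ) := Real.log_nonneg (by rw [le_div_iff₀ hδ]; linarith)
  have hmL : m ≤ L := max_le_max le_rfl (by linarith)
  have hlL : Real.log (1 / δ) ≤ L := (by linarith : _ ≤ _).trans (le_max_right _ _)
  have hm1 : 1 ≤ m := le_max_left _ _
  have hkm : (k : ℝ) ≤ 2 * m := self_le_two_mul_max k
  have hklm : (k : ℝ) * Real.log k ≤ m := le_max_right _ _
  have h2a := Real.log_two_gt_d9
  have h2b := Real.log_two_lt_d9
  have h4 : Real.log 4 = 2 * Real.log 2 := by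
    rw [show (4 : ℝ) = 2 ^ 2 by norm_num, Real.log_pow]
    norm_num
  have hj : (0 : ℝ) ≤ j := Nat.cast_nonneg j
  have hpow : (1 : ℝ) ≤ 4 ^ j := one_le_pow₀ (by norm_num)
  have hA : Real.log ((2 * k * 4 ^ j + 1 : ℕ) : ℝ) ≤ Real.log 4 * (j + 1) + Real.log k := by
    have : ((2 * k * 4 ^ j + 1 : ℕ) : ℝ) ≤ 4 ^ (j + 1) * k := by
      push_cast
      rw [pow_succ]
      nlinarith [mul_le_mul hk' hpow (by norm_num) (by positivity)]
    refine (Real.log_le_log (by positivity) this).trans (le_of_eq ?_)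
    rw [Real.log_mul (by positivity) (by positivity), Real.log_pow]
    push_cast
    ring
  have hB : (k : ℝ) * Real.log ((2 * k * 4 ^ j + 1 : ℕ) : ℝ) ≤ 4 * m * (j + 1) := by
    have e1 : (k : ℝ) * Real.log ((2 * k * 4 ^ j + 1 : ℕ) : ℝ) ≤
        k * (1.4 * (j + 1) + Real.log k) := by
      refine mul_le_mul_of_nonneg_left (hA.trans ?_) (by positivity)
      nlinarith
    have e2 : (k : ℝ) * (1.4 * (j + 1)) ≤ 2 * m * (1.4 * (j + 1)) := by gcongr
    nlinarith
  have hC : Real.log (4 * (((2 * k * 4 ^ j + 1 : ℕ) : ℝ) ^ k) ^ 2) + (j + 1) * Real.log 2 +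
      Real.log (1 / δ) ≤ y * (j + 1) ^ 2 / 20480 := by
    rw [Real.log_mul (by norm_num) (by positivity), Real.log_pow, Real.log_pow]
    push_cast at hB ⊢
    have e1 : Real.log 4 + 2 * (4 * m * (j + 1)) + (j + 1) * Real.log 2 + Real.log (1 / δ) ≤
        12 * L * (j + 1) := by
      have f1 : m * (j + 1) ≤ L * (j + 1) := by gcongr
      have f2 : L ≤ L * (j + 1) := by nlinarith
      nlinarith
    have e2 : 12 * L * (j + 1) ≤ y * (j + 1) ^ 2 / 20480 := by
      have f1 : 0 ≤ L := by linarith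
      have f2 : L * (j + 1) ≤ L * (j + 1) ^ 2 := by
        gcongr
        nlinarith
      have f3 : 500000 * L * (j + 1) ^ 2 ≤ y * (j + 1) ^ 2 := by gcongr
      have f4 : 0 ≤ L * (j + 1) := by positivity
      linarith
    linarith
  have hpos : (0 : ℝ) < 4 * (((2 * k * 4 ^ j + 1 : ℕ) : ℝ) ^ k) ^ 2 := by positivity
  have hD : δ / 2 ^ (j + 1) = Real.exp (-((j + 1) * Real.log 2 + Real.log (1 / δ))) := by
    rw [neg_add, Real.exp_add, one_div, Real.log_inv, neg_neg, Real.exp_log hδ, Real.exp_neg,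
      show ((j : ℝ) + 1) * Real.log 2 = ((j + 1 : ℕ) : ℝ) * Real.log 2 by push_cast; ring,
      Real.exp_nat_mul, Real.exp_log two_pos]
    ring
  rw [hD]
  nth_rewrite 1 [← Real.exp_log hpos]
  rw [← Real.exp_add]
  exact Real.exp_le_exp.2 (by linarith)

/-- Uniform convergence of the empirical objectives over the class of policies that respect the
change-points `S`. -/
theorem sampleLaw_exists_deviation_gt_le (obj : Objective) (S : Finset (Fin n))
    (D : Measure (UnitVec n)) [IsProbabilityMeasure D] {ε δ : ℝ} (hε : 0 < ε) (hε1 : ε < 1)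
    (hδ : 0 < δ) (hδ1 : δ < 1) {T : ℕ}
    (hT : 500000 * max 1 ((1 + (S.card : ℝ)) * Real.log (1 + (S.card : ℝ)) + Real.log (1 / δ)) /
      ε ^ 2 ≤ T) :
    sampleLaw T D {x | ∃ p ∈ changePointClass S, ε / 2 < |deviation D (objective obj p) x|} ≤
      ENNReal.ofReal δ := by
  have hkcast : ((S.card + 1 : ℕ) : ℝ) = 1 + (S.card : ℝ) := by push_cast; ring
  rw [← hkcast, div_le_iff₀ (by positivity)] at hT
  have hT0 : 0 < T := by
    rcases Nat.eq_zero_or_pos T with rfl | h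
    · have := le_max_left 1
        (((S.card + 1 : ℕ) : ℝ) * Real.log ((S.card + 1 : ℕ) : ℝ) + Real.log (1 / δ))
      simp only [Nat.cast_zero, zero_mul] at hT
      linarith
    · exact h
  -- Chosen so that the mean oscillation 2k/K of a product cell equals 4^(-j).
  let K : ℕ → ℕ := fun j => 2 * (S.card + 1) * 4 ^ j
  have hK : ∀ j, 0 < K j := fun j => by positivity
  choose cell w h1 h2 h3 h4 h5 using fun j => exists_product_cells D
    (Ψ := blockPayoff obj S) (F := fun θ => objective obj (blockPolicy S θ))
    (measurable_blockPayoff obj S) (blockPayoff_mono obj S) (blockPayoff_mem_Icc obj S)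
    (fun θ => objective_mem_Icc obj _) (abs_objective_blockPolicy_sub_le obj S) (hK j)
  have hset : {x : Fin T → UnitVec n | ∃ p ∈ changePointClass S,
      ε / 2 < |deviation D (objective obj p) x|} =
      {x | ∃ θ, ε / 2 < |deviation D (objective obj (blockPolicy S θ)) x|} := by
    ext x
    simp [changePointClass_eq_range]
  rw [hset, sampleLaw]
  refine measure_exists_deviation_gt_le D (ι := fun j => Fin (S.card + 1) → Fin (K j + 1))
    (N := fun j => ((K j + 1 : ℕ) : ℝ) ^ (S.card + 1)) (fun θ => measurable_objective obj _)
    (fun θ => objective_mem_Icc obj _) h1 h2 h3 (fun j a => (h4 j a).trans (le_of_eq ?_)) h5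
    (fun j => ?_) (fun i j hij => ?_) (fun j => ?_) hT0 hε hε1 hδ fun j => ?_
  · simp only [Fintype.card_fin, K]
    push_cast
    field_simp
  · simp
  · have : K i ≤ K j := Nat.mul_le_mul_left _ (Nat.pow_le_pow_right (by norm_num) hij)
    simp only
    gcongr
  · exact one_le_pow₀ (by exact_mod_cast Nat.le_add_left 1 (K j))
  · exact size_bound (Nat.succ_le_succ (Nat.zero_le _)) hδ hδ1 hT j

end UniformConvergence

/-! ### Empirical maximizers: existence, measurable selection, accuracy -/

/-- Among finitely many measurable candidates, a best one can be selected measurably. -/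
theorem exists_measurable_maximizer {Ω Y ι : Type*} [MeasurableSpace Ω] [MeasurableSpace Y]
    {φ : Ω × Y → ℝ} (hφ : Measurable φ) {c : ι → Ω → Y} (hc : ∀ i, Measurable (c i))
    {s : Finset ι} (hs : s.Nonempty) :
    ∃ g : Ω → Y, Measurable g ∧ (∀ x, ∃ i ∈ s, g x = c i x) ∧
      ∀ i ∈ s, ∀ x, φ (x, c i x) ≤ φ (x, g x) := by
  classical
  induction hs using Finset.Nonempty.cons_induction with
  | singleton i =>
    refine ⟨c i, hc i, fun x => ⟨i, by simp, rfl⟩, fun j hj x => ?_⟩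
    rw [Finset.mem_singleton] at hj
    rw [hj]
  | cons i s hi hs ih =>
    obtain ⟨g, hg, hmem, hmax⟩ := ih
    refine ⟨fun x => if φ (x, g x) ≤ φ (x, c i x) then c i x else g x, ?_, fun x => ?_,
      fun j hj x => ?_⟩
    · exact Measurable.ite (measurableSet_le (hφ.comp (measurable_id.prodMk hg))
        (hφ.comp (measurable_id.prodMk (hc i)))) (hc i) hg
    · simp only
      split_ifs
      · exact ⟨i, by simp, rfl⟩
      · obtain ⟨j, hj, h⟩ := hmem x
        exact ⟨j, by simp [hj], h⟩
    · simp only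
      rcases Finset.mem_cons.1 hj with rfl | hj
      · split_ifs with h
        · exact le_rfl
        · exact (not_le.1 h).le
      · split_ifs with h
        · exact (hmax j hj x).trans h
        · exact hmax j hj x

section SAA

variable {n : ℕ}

/-- The same buyers accept, so the winner is the same; welfare is unchanged and revenue can only
rise. -/
theorem objective_le_objective (obj : Objective) {p q v : UnitVec n} (hpq : ∀ i, p i ≤ q i)
    (hv : ∀ i, p i ≤ v i ↔ q i ≤ v i) : objective obj p v ≤ objective obj q v := by
  rw [objective_eq_firstValue, objective_eq_firstValue]
  simp only [hv]
  by_cases h : ∃ i, q i ≤ v i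
  · obtain ⟨i, hi⟩ := exists_isFirst h
    rw [firstValue_of_isFirst hi, firstValue_of_isFirst hi]
    cases obj
    · exact le_rfl
    · exact hpq i
  · rw [firstValue_of_not_exists h, firstValue_of_not_exists h]

/-- A candidate price: one of the sampled values, or `1`. -/
def candidatePrice {T : ℕ} (o : Option (Fin T × Fin n)) (x : Fin T → UnitVec n) : unitInterval :=
  o.elim 1 fun a => x a.1 a.2

/-- The policy that offers the given candidate price in each block. -/
def candidatePolicy (S : Finset (Fin n)) {T : ℕ}
    (κ : Fin (S.card + 1) → Option (Fin T × Fin n)) (x : Fin T → UnitVec n) : UnitVec n :=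
  blockPolicy S fun β => candidatePrice (κ β) x

theorem measurable_candidatePolicy (S : Finset (Fin n)) {T : ℕ}
    (κ : Fin (S.card + 1) → Option (Fin T × Fin n)) : Measurable (candidatePolicy S κ) := by
  refine measurable_pi_lambda _ fun i => ?_
  simp only [candidatePolicy, blockPolicy, candidatePrice]
  cases κ (blockIndex S i) with
  | none => exact measurable_const
  | some a => exact (measurable_pi_apply a.2).comp (measurable_pi_apply a.1)

theorem exists_candidatePolicy_ge (obj : Objective) (S : Finset (Fin n)) {T : ℕ}
    (x : Fin T → UnitVec n) {p : UnitVec n} (hp : p ∈ changePointClass S) :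
    ∃ κ, empiricalObjective obj x p ≤ empiricalObjective obj x (candidatePolicy S κ x) := by
  obtain ⟨θ, rfl⟩ := exists_blockPolicy_eq hp
  -- Round each block price up to the nearest candidate; the candidate 1 ensures that there is one.
  -- Any sampled value that meets the old price is itself a candidate, so it also meets the new one.
  have hex : ∀ β, ∃ o : Option (Fin T × Fin n), θ β ≤ candidatePrice o x ∧
      ∀ o', θ β ≤ candidatePrice o' x → candidatePrice o x ≤ candidatePrice o' x := fun β =>
    Set.exists_min_image {o | θ β ≤ candidatePrice o x} (fun o => candidatePrice o x)
      (Set.toFinite _) ⟨none, unitInterval.le_one _⟩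
  choose κ h1 h2 using hex
  refine ⟨κ, mul_le_mul_of_nonneg_left (Finset.sum_le_sum fun t _ => ?_) (by positivity)⟩
  refine objective_le_objective obj (fun i => h1 _) fun i => ⟨fun h => ?_, (h1 _).trans⟩
  exact h2 (blockIndex S i) (some (t, i)) h

theorem measurable_empiricalObjective (obj : Objective) {T : ℕ} :
    Measurable fun a : (Fin T → UnitVec n) × UnitVec n => empiricalObjective obj a.1 a.2 :=
  measurable_const.mul (Finset.measurable_sum _ fun t _ => (measurable_objective_uncurry obj).comp
    (measurable_snd.prodMk ((measurable_pi_apply t).comp measurable_fst)))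

/-- A maximizer of the empirical objective can be selected measurably. -/
theorem exists_measurable_isSAA (obj : Objective) (S : Finset (Fin n)) (T : ℕ) :
    ∃ g : (Fin T → UnitVec n) → UnitVec n, Measurable g ∧
      ∀ x, IsSAA obj (changePointClass S) x (g x) := by
  obtain ⟨g, hg, hmem, hmax⟩ := exists_measurable_maximizer
    (measurable_empiricalObjective (n := n) obj (T := T)) (measurable_candidatePolicy S)
    (Finset.univ_nonempty (α := Fin (S.card + 1) → Option (Fin T × Fin n)))
  refine ⟨g, hg, fun x => ⟨?_, fun q hq => ?_⟩⟩
  · obtain ⟨κ, -, h⟩ := hmem x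
    rw [h]
    exact blockPolicy_mem S _
  · obtain ⟨κ, hκ⟩ := exists_candidatePolicy_ge obj S x hq
    exact hκ.trans (hmax κ (Finset.mem_univ _) x)

variable (D : Measure (UnitVec n))

theorem deviation_objective (obj : Objective) {T : ℕ} (x : Fin T → UnitVec n) (p : UnitVec n) :
    deviation D (objective obj p) x = empiricalObjective obj x p - expectedObjective obj D p :=
  rfl

theorem isApprox_of_isSAA (obj : Objective) {P : Set (UnitVec n)} {T : ℕ} {x : Fin T → UnitVec n}
    {ε : ℝ} (hdev : ∀ p ∈ P, |deviation D (objective obj p) x| ≤ ε / 2) {p : UnitVec n}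
    (hp : IsSAA obj P x p) : IsApprox obj P D ε p := by
  refine ⟨hp.1, ?_⟩
  rw [sub_le_iff_le_add]
  refine csSup_le ⟨_, p, hp.1, rfl⟩ ?_
  rintro _ ⟨q, hq, rfl⟩
  have h1 := abs_le.1 (hdev p hp.1)
  have h2 := abs_le.1 (hdev q hq)
  rw [deviation_objective] at h1 h2
  linarith [hp.2 q hq, h1.2, h2.1]

theorem measurableSet_isApprox [IsProbabilityMeasure D] (obj : Objective) (S : Finset (Fin n))
    (ε : ℝ) : MeasurableSet {p | IsApprox obj (changePointClass S) D ε p} := by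
  refine MeasurableSet.inter (s₁ := changePointClass S)
    (s₂ := {p | optimum obj (changePointClass S) D - ε ≤ expectedObjective obj D p}) ?_
    (measurableSet_le measurable_const ?_)
  · simp only [changePointClass, Set.ofPred_forall]
    exact MeasurableSet.iInter fun i => MeasurableSet.iInter fun j => MeasurableSet.iInter fun _ =>
      MeasurableSet.iInter fun _ =>
        measurableSet_eq_fun (measurable_pi_apply j) (measurable_pi_apply i)
  · exact ((measurable_objective_uncurry obj).stronglyMeasurable.integral_prod_right').measurable

/-- SAA returns an `ε`-approximation with probability at least `1 - δ`, however ties are broken. -/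
theorem sampleLaw_isSAA_not_isApprox_le [IsProbabilityMeasure D] (obj : Objective)
    (S : Finset (Fin n)) {ε δ : ℝ} (hε : 0 < ε) (hε1 : ε < 1) (hδ : 0 < δ) (hδ1 : δ < 1) {T : ℕ}
    (hT : 500000 * max 1 ((1 + (S.card : ℝ)) * Real.log (1 + (S.card : ℝ)) + Real.log (1 / δ)) /
      ε ^ 2 ≤ T) :
    sampleLaw T D {x | ∃ p, IsSAA obj (changePointClass S) x p ∧
      ¬ IsApprox obj (changePointClass S) D ε p} ≤ ENNReal.ofReal δ := by
  refine (measure_mono ?_).trans (sampleLaw_exists_deviation_gt_le obj S D hε hε1 hδ hδ1 hT)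
  rintro x ⟨p, hp, hnot⟩
  by_contra hx
  simp only [Set.mem_ofPred_eq, not_exists, not_and, not_lt] at hx
  exact hnot (isApprox_of_isSAA D obj hx hp)

theorem samplesSuffice (obj : Objective) (S : Finset (Fin n)) {ε δ : ℝ} (hε : 0 < ε) (hε1 : ε < 1)
    (hδ : 0 < δ) (hδ1 : δ < 1) {T : ℕ}
    (hT : 500000 * max 1 ((1 + (S.card : ℝ)) * Real.log (1 + (S.card : ℝ)) + Real.log (1 / δ)) /
      ε ^ 2 ≤ T) : SamplesSuffice obj (changePointClass S) ε δ T := by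
  obtain ⟨g, hg, hSAA⟩ := exists_measurable_isSAA obj S T
  refine ⟨Kernel.deterministic g hg, inferInstance, fun D hD => ?_⟩
  have : IsProbabilityMeasure (sampleLaw T D) :=
    inferInstanceAs (IsProbabilityMeasure (Measure.pi fun _ : Fin T => D))
  have hmeas := measurableSet_isApprox D obj S ε
  rw [Measure.deterministic_comp_eq_map, Measure.map_apply hg hmeas]
  have hbad : sampleLaw T D (g ⁻¹' {p | IsApprox obj (changePointClass S) D ε p})ᶜ ≤
      ENNReal.ofReal δ := by
    refine (measure_mono ?_).trans (sampleLaw_isSAA_not_isApprox_le D obj S hε hε1 hδ hδ1 hT)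
    exact fun x hx => ⟨g x, hSAA x, hx⟩
  rw [ENNReal.ofReal_sub _ hδ.le, ENNReal.ofReal_one, tsub_le_iff_right]
  calc (1 : ENNReal) = sampleLaw T D (g ⁻¹' {p | IsApprox obj (changePointClass S) D ε p}) +
        sampleLaw T D (g ⁻¹' {p | IsApprox obj (changePointClass S) D ε p})ᶜ := by
        rw [measure_add_measure_compl (hg hmeas), measure_univ]
    _ ≤ _ := add_le_add le_rfl hbad

end SAA

end PostedPricing

end

/-! ### Assembly of the three bounds -/

open MeasureTheory PostedPricing in
theorem theorem3 :
    ∃ C : ℝ, 0 < C ∧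
      ∀ (n : ℕ) (S : Finset (Fin n)), (∀ i ∈ S, (i : ℕ) ≠ 0) → ∀ obj : Objective,
        -- the pseudo-dimension of the class
        ((pseudoDim (objective obj '' changePointClass S) : ℕ∞) : ENNReal) ≤
            ENNReal.ofReal (C * max 1 ((1 + (S.card : ℝ)) * Real.log (1 + (S.card : ℝ)))) ∧
        ∀ ε δ : ℝ, 0 < ε → ε < 1 → 0 < δ → δ < 1 →
          -- the sample complexity
          ((sampleComplexity obj (changePointClass S) ε δ : ℕ∞) : ENNReal) ≤
            ENNReal.ofReal (C * max 1 ((1 + (S.card : ℝ)) * Real.log (1 + (S.card : ℝ))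
              + Real.log (1 / δ)) / ε ^ 2) ∧
          -- sample average approximation achieves the bound, however ties are broken
          ∀ T : ℕ, C * max 1 ((1 + (S.card : ℝ)) * Real.log (1 + (S.card : ℝ))
              + Real.log (1 / δ)) / ε ^ 2 ≤ (T : ℝ) →
            (∀ x : Fin T → UnitVec n, ∃ p, IsSAA obj (changePointClass S) x p) ∧
            ∀ D : Measure (UnitVec n), IsProbabilityMeasure D →
              sampleLaw T D {x | ∃ p, IsSAA obj (changePointClass S) x p ∧
                ¬ IsApprox obj (changePointClass S) D ε p} ≤ ENNReal.ofReal δ := by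
  -- Twice the constant of uniform convergence: the spare half absorbs the rounding of the sample
  -- size to an integer.
  refine ⟨1000000, by norm_num, fun n S _ obj => ⟨?_, fun ε δ hε hε1 hδ hδ1 => ?_⟩⟩
  · refine (pseudoDim_changePointClass_le obj S).trans (ENNReal.ofReal_le_ofReal ?_)
    gcongr
    norm_num
  set L := max 1 ((1 + (S.card : ℝ)) * Real.log (1 + (S.card : ℝ)) + Real.log (1 / δ)) with hL
  have hL1 : 1 ≤ L := le_max_left _ _
  have hhalf : 1000000 * L / ε ^ 2 = 500000 * L / ε ^ 2 + 500000 * L / ε ^ 2 := by ring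
  have hone : 1 ≤ 500000 * L / ε ^ 2 := by
    rw [le_div_iff₀ (by positivity)]
    nlinarith
  refine ⟨?_, fun T hT => ?_⟩
  · have hceil := Nat.le_ceil (500000 * L / ε ^ 2)
    have hle : sampleComplexity obj (changePointClass S) ε δ ≤
        ((⌈500000 * L / ε ^ 2⌉₊ : ℕ) : ℕ∞) :=
      iInf₂_le _ (samplesSuffice obj S hε hε1 hδ hδ1 hceil)
    refine (ENat.toENNReal_le.2 hle).trans ?_
    rw [ENat.toENNReal_coe, ← ENNReal.ofReal_natCast]
    refine ENNReal.ofReal_le_ofReal ?_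
    have := Nat.ceil_lt_add_one (zero_le_one.trans hone)
    linarith
  · have hT' : 500000 * L / ε ^ 2 ≤ T := by linarith
    refine ⟨fun x => ?_, fun D hD => sampleLaw_isSAA_not_isApprox_le D obj S hε hε1 hδ hδ1 hT'⟩
    obtain ⟨g, -, hg⟩ := exists_measurable_isSAA obj S T
    exact ⟨g x, hg x⟩
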